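/- **Setting.** Let $d\in\mathbb N$, let $M_n=M_n(\mathbb C)$ carry the operator norm, and let $\mathbb M^d=\bigsqcup_{n\ge 1}M_n^d$. Let $\mathcal R,\mathcal S$ be complex Hilbert spaces and let $Q_1,\dots,Q_d\in\mathcal L(\mathcal R,\mathcal S)$ be linearly independent. For $X\in M_n^d$ put $Q(X)=\sum_{j=1}^d Q_j\otimes X_j\in\mathcal L(\mathcal R^n,\mathcal S^n)$, and let $\mathbb D_Q=\{X\in\mathbb M^d:\|Q(X)\|<1\}$ be the corresponding nc operator ball, with levels $\mathbb D_Q(n)=\mathbb D_Q\cap M_n^d$. For $\Omega\subseteq\mathbb D_Q$, a function $F:\Omega\to\mathbb M^1$ is *nc* if it is graded ($F(X)\in M_n$ for $X\in\Omega(n)$) and respects direct sums and similarities, i.e. $F(X\oplus Y)=F(X)\oplus F(Y)$ and $F(S^{-1}XS)=S^{-1}F(X)S$ whenever all the points involved lie in $\Omega$. Let $H^\infty(\Omega)$ be the unital algebra of nc functions $F$ on $\Omega$ with $\|F\|=\sup_{X\in\Omega}\|F(X)\|<\infty$. A *completely contractive representation* of $H^\infty(\Omega)$ is a unital algebra homomorphism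 $\Phi:H^\infty(\Omega)\to M_n$, for some $n\ge 1$, such that $\|[\Phi(F_{ij})]\|\le\sup_{X\in\Omega}\|[F_{ij}(X)]\|$ for all $k$ and all $[F_{ij}]\in M_k(H^\infty(\Omega))$. Put $\pi(\Phi)=(\Phi(Z_1|_\Omega),\dots,\Phi(Z_d|_\Omega))$, where $Z_1,\dots,Z_d$ are the coordinate functions, and for $X\in\Omega$ let $\Phi_X(F)=F(X)$. An *nc subvariety* of $\mathbb D_Q$ is the common zero set in $\mathbb D_Q$ of some set of functions in $H^\infty(\mathbb D_Q)$. For a word $w=w_1\cdots w_N$ in $\{1,\dots,d\}$ write $X^w=X_{w_1}\cdots X_{w_N}$. For an nc function $f$ on $\mathbb D_Q$ and $X\in\mathbb D_Q(n)$, the difference-differential $\Delta^wf(0,\dots,0,X)\in M_n$ is $t^{-N}$ times the upper right $n\times n$ block of $f(T)$, where $T$ is the $d$-tuple of block upper bidiagonal matrices, of $(N+1)\times(N+1)$ blocks of size $n$, whose $j$-th entry has diagonal blocks $0,\dots,0,X_j$ and $l$-th superdiagonal block $tI_n$ if $w_l=j$ and $0$ otherwise; here $t>0$ is small enough that $T\in\mathbb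 D_Q$, and the result does not depend on $t$. Let $\mathcal J_N$ be the weak-* closed two-sided ideal of $H^\infty(\mathbb D_Q)$ generated by the monomials $Z^w$ with $|w|=N$, where the weak-* topology is the one given by the predual $\overline{\operatorname{span}}\{F\mapsto\eta(F(X)): n\ge 1,\ X\in\mathbb D_Q(n),\ \eta\in M_n^*\}\subseteq H^\infty(\mathbb D_Q)^*$. The ball $\mathbb D_Q$ is *right regular* if $\Delta^wf(0,\dots,0,\cdot)\in H^\infty(\mathbb D_Q)$ for every $f\in H^\infty(\mathbb D_Q)$ and every word $w$, and there is a constant $M$ such that for every $N$ and every $f\in\mathcal J_N$ $$\Big(\sup_{X\in\mathbb D_Q}\big\|\operatorname{row}(X^w)_{|w|=N}\big\|\Big)\cdot\Big(\sup_{X\in\mathbb D_Q}\big\|\operatorname{col}(\Delta^wf(0,\dots,0,X))_{|w|=N}\big\|\Big)\le M\|f\|.$$ **Statement.** Suppose that $\mathbb D_Q$ is right regular. Then for every $X\in\mathbb D_Q$ there is a unique completely contractive representation $\Phi$ of $H^\infty(\mathbb D_Q)$ with $\pi(\Phi)=X$, namely $\Phi=\Phi_X$. Moreover, for every nc subvariety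 $\mathfrak V\subseteq\mathbb D_Q$ and every $X\in\mathfrak V$, there is a unique completely contractive representation $\Phi$ of $H^\infty(\mathfrak V)$ with $\pi(\Phi)=X$, namely $\Phi=\Phi_X$. -/

import Mathlib

open scoped ENNReal NNReal Matrix.Norms.L2Operator

noncomputable section

namespace NCBall

/-- The index set `{0, …, n - 1}` of the `n`-th level, `n ≥ 1`. -/
def Idx (n : ℕ+) : Type := Fin n

instance (n : ℕ+) : Fintype (Idx n) := inferInstanceAs (Fintype (Fin n))
instance (n : ℕ+) : DecidableEq (Idx n) := inferInstanceAs (DecidableEq (Fin n))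
instance (n : ℕ+) : Nonempty (Idx n) := inferInstanceAs (Nonempty (Fin n))

/-- `Mat n` is the algebra of complex `n × n` matrices; its norm is the operator norm. -/
abbrev Mat (n : ℕ+) : Type := Matrix (Idx n) (Idx n) ℂ

/-- The `n`-th level of the `d`-dimensional nc universe. -/
abbrev Tup (d : ℕ) (n : ℕ+) : Type := Fin d → Mat n

/-- A graded subset of the `d`-dimensional nc universe, given by its levels. -/
abbrev GradedSet (d : ℕ) : Type := ∀ n : ℕ+, Set (Tup d n)

/-- A graded function into the one-dimensional nc universe. -/
abbrev GradedFun {d : ℕ} (Ω : GradedSet d) : Type := ∀ n : ℕ+, Ω n → Mat n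

/-- The standard bijection between the indices of two consecutive blocks and `0, …, m + n - 1`. -/
def sumEquiv (m n : ℕ+) : Idx m ⊕ Idx n ≃ Idx (m + n) := finSumFinEquiv (m := m) (n := n)

/-- The standard bijection between the indices of `N + 1` consecutive blocks of size `n` and
`0, …, (N + 1) * n - 1`. -/
def blockEquiv (N : ℕ) (n : ℕ+) : Fin (N + 1) × Idx n ≃ Idx (N.succPNat * n) :=
  finProdFinEquiv (m := N + 1) (n := n)

/-- The block diagonal direct sum of two square matrices. -/
def dsum {m n : ℕ+} (A : Mat m) (B : Mat n) : Mat (m + n) :=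
  Matrix.reindex (sumEquiv m n) (sumEquiv m n) (Matrix.fromBlocks A 0 0 B)

/-- The coordinatewise direct sum of two tuples. -/
def dsumTup {d : ℕ} {m n : ℕ+} (X : Tup d m) (Y : Tup d n) : Tup d (m + n) :=
  fun j => dsum (X j) (Y j)

/-- The similarity action of an invertible matrix on a tuple. -/
def conjTup {d : ℕ} {n : ℕ+} (S : (Mat n)ˣ) (X : Tup d n) : Tup d n :=
  fun j => (↑S⁻¹ : Mat n) * X j * (S : Mat n)

/-- A graded function is an nc function if it respects direct sums and similarities. -/
structure IsNC {d : ℕ} {Ω : GradedSet d} (F : GradedFun Ω) : Prop where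
  map_dsum : ∀ (m n : ℕ+) (X : Ω m) (Y : Ω n) (h : dsumTup X.1 Y.1 ∈ Ω (m + n)),
    F (m + n) ⟨dsumTup X.1 Y.1, h⟩ = dsum (F m X) (F n Y)
  map_conj : ∀ (n : ℕ+) (S : (Mat n)ˣ) (X : Ω n) (h : conjTup S X.1 ∈ Ω n),
    F n ⟨conjTup S X.1, h⟩ = (↑S⁻¹ : Mat n) * F n X * (S : Mat n)

/-- A graded function is bounded if its values are uniformly bounded over all levels. -/
def IsBdd {d : ℕ} {Ω : GradedSet d} (F : GradedFun Ω) : Prop :=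
  ∃ C : ℝ, ∀ (n : ℕ+) (X : Ω n), ‖F n X‖ ≤ C

section
variable {m n : ℕ+}

theorem dsum_mul (A A' : Mat m) (B B' : Mat n) :
    dsum (A * A') (B * B') = dsum A B * dsum A' B' := by
  have h := map_mul (Matrix.reindexAlgEquiv ℂ ℂ (sumEquiv m n))
    (Matrix.fromBlocks A 0 0 B) (Matrix.fromBlocks A' 0 0 B')
  rw [Matrix.fromBlocks_multiply] at h
  simp only [Matrix.mul_zero, Matrix.zero_mul, add_zero, zero_add] at h
  exact h

theorem dsum_add (A A' : Mat m) (B B' : Mat n) :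
    dsum (A + A') (B + B') = dsum A B + dsum A' B' := by
  have h := map_add (Matrix.reindexAlgEquiv ℂ ℂ (sumEquiv m n))
    (Matrix.fromBlocks A 0 0 B) (Matrix.fromBlocks A' 0 0 B')
  rw [Matrix.fromBlocks_add, add_zero, add_zero] at h
  exact h

theorem dsum_smul_one (c : ℂ) :
    dsum (c • (1 : Mat m)) (c • (1 : Mat n)) = c • (1 : Mat (m + n)) := by
  have h := map_smul (Matrix.reindexAlgEquiv ℂ ℂ (sumEquiv m n)) c (1 : Matrix _ _ ℂ)
  rw [map_one, ← Matrix.fromBlocks_one, Matrix.fromBlocks_smul, smul_zero, smul_zero] at h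
  exact h

end

/-- The algebra of bounded nc functions on `Ω`, with pointwise operations. -/
def HInf {d : ℕ} (Ω : GradedSet d) : Subalgebra ℂ (GradedFun Ω) where
  carrier := {F | IsNC F ∧ IsBdd F}
  mul_mem' := by
    rintro F G ⟨hF, C, hC⟩ ⟨hG, D, hD⟩
    refine ⟨⟨fun m n X Y h => ?_, fun n S X h => ?_⟩, C * D, fun n X => ?_⟩
    · simp only [Pi.mul_apply, hF.map_dsum, hG.map_dsum, dsum_mul]
    · simp only [Pi.mul_apply, hF.map_conj, hG.map_conj]
      simp only [mul_assoc, Units.mul_inv_cancel_left]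
    · exact (norm_mul_le _ _).trans
        (mul_le_mul (hC n X) (hD n X) (norm_nonneg _) ((norm_nonneg _).trans (hC n X)))
  add_mem' := by
    rintro F G ⟨hF, C, hC⟩ ⟨hG, D, hD⟩
    refine ⟨⟨fun m n X Y h => ?_, fun n S X h => ?_⟩, C + D, fun n X => ?_⟩
    · simp only [Pi.add_apply, hF.map_dsum, hG.map_dsum, dsum_add]
    · simp only [Pi.add_apply, hF.map_conj, hG.map_conj, mul_add, add_mul]
    · exact (norm_add_le _ _).trans (add_le_add (hC n X) (hD n X))
  algebraMap_mem' := by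
    intro c
    have key : ∀ (n : ℕ+) (X : Ω n),
        (algebraMap ℂ (GradedFun Ω) c) n X = c • (1 : Mat n) := fun n X => by
      rw [Pi.algebraMap_apply, Pi.algebraMap_apply, Algebra.algebraMap_eq_smul_one]
    refine ⟨⟨fun m n X Y h => ?_, fun n S X h => ?_⟩, ‖c‖, fun n X => ?_⟩
    · simp only [key, dsum_smul_one]
    · simp [key]
    · rw [key, norm_smul, norm_one, mul_one]

/-- The point evaluation `F ↦ F(X)`. -/
def pointEval {d : ℕ} {Ω : GradedSet d} {n : ℕ+} (X : Ω n) : HInf Ω →ₐ[ℂ] Mat n where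
  toFun F := F.1 n X
  map_one' := rfl
  map_mul' _ _ := rfl
  map_zero' := rfl
  map_add' _ _ := rfl
  commutes' _ := rfl

/-- Supremum norm of a family of (possibly rectangular) matrices over all levels of `Ω`. -/
def supNorm {d : ℕ} {Ω : GradedSet d} {ι κ : ℕ+ → Type}
    [∀ n, Fintype (ι n)] [∀ n, Fintype (κ n)] [∀ n, DecidableEq (κ n)]
    (G : ∀ n : ℕ+, Ω n → Matrix (ι n) (κ n) ℂ) : ℝ≥0∞ :=
  ⨆ (n : ℕ+) (X : Ω n), ‖G n X‖ₑ

/-- A representation is completely contractive if, for every `k`, its `k`-th amplification is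
contractive, where a `k × k` matrix over `HInf Ω` is normed as a matrix-valued function. -/
def IsCC {d : ℕ} {Ω : GradedSet d} {n : ℕ+} (Φ : HInf Ω →ₐ[ℂ] Mat n) : Prop :=
  ∀ (k : ℕ) (A : Matrix (Fin k) (Fin k) (HInf Ω)),
    ‖Matrix.comp _ _ _ _ _ (A.map Φ)‖ₑ ≤
      supNorm (Ω := Ω) (fun m X => Matrix.comp _ _ _ _ _ (A.map fun F => F.1 m X))

/-! ### The operator ball of a linear operator-valued polynomial -/

section Ball

universe u v

variable {d : ℕ} {R : Type u} {S : Type v}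
  [NormedAddCommGroup R] [InnerProductSpace ℂ R]
  [NormedAddCommGroup S] [InnerProductSpace ℂ S]

/-- `Q(X) = ∑ j, Q j ⊗ X j`, as an operator between the Hilbert space direct sums
`Rⁿ` and `Sⁿ`. -/
def evalQ (Q : Fin d → R →L[ℂ] S) {ι : Type} [Fintype ι] (X : Fin d → Matrix ι ι ℂ) :
    PiLp 2 (fun _ : ι => R) →L[ℂ] PiLp 2 (fun _ : ι => S) :=
  (PiLp.continuousLinearEquiv 2 ℂ (fun _ : ι => S)).symm.toContinuousLinearMap ∘L
    ContinuousLinearMap.pi fun i =>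
      ∑ k, (∑ j, X j i k • Q j) ∘L PiLp.proj (𝕜 := ℂ) 2 (fun _ : ι => R) k

/-- The nc operator ball `{X : ‖Q(X)‖ < 1}`. -/
def opBall (Q : Fin d → R →L[ℂ] S) : GradedSet d := fun _ => {X | ‖evalQ Q X‖ < 1}

theorem evalQ_apply (Q : Fin d → R →L[ℂ] S) {ι : Type} [Fintype ι] (X : Fin d → Matrix ι ι ℂ)
    (x : PiLp 2 (fun _ : ι => R)) (i : ι) :
    evalQ Q X x i = ∑ k, ∑ j, X j i k • Q j (x k) := by
  simp [evalQ]

/-- Operator balls of linearly independent coefficients are uniformly bounded. -/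
theorem opBall_bounded (Q : Fin d → R →L[ℂ] S) (hQ : LinearIndependent ℂ Q) (j : Fin d) :
    ∃ C : ℝ, ∀ (n : ℕ+) (X : Tup d n), X ∈ opBall Q n → ‖X j‖ ≤ C := by
  obtain ⟨K, -, hK⟩ := LinearMap.exists_antilipschitzWith (Fintype.linearCombination ℂ Q)
    (LinearMap.ker_eq_bot.2 (linearIndependent_iff_injective_fintypeLinearCombination.1 hQ))
  refine ⟨K, fun n X hX => ?_⟩
  have hX : ‖evalQ Q X‖ < 1 := hX
  rw [Matrix.cstar_norm_def]
  refine ContinuousLinearMap.opNorm_le_bound _ K.2 fun x => ?_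
  set y : EuclideanSpace ℂ (Idx n) := Matrix.toEuclideanCLM (n := Idx n) (𝕜 := ℂ) (X j) x with hy
  let c : Fin d → ℂ := fun l => ∑ i, star (y i) * ∑ k, X l i k * x k
  have hcj : c j = (‖y‖ : ℂ) ^ 2 := by
    have h1 : ∀ i, y i = ∑ k, X j i k * x k := fun i => rfl
    refine Eq.trans ?_ (inner_self_eq_norm_sq_to_K (𝕜 := ℂ) y)
    rw [PiLp.inner_apply]
    simp only [c, ← h1]
    exact Finset.sum_congr rfl fun i _ => (mul_comm _ _)
  have hop : ‖Fintype.linearCombination ℂ Q c‖ ≤ ‖x‖ * ‖y‖ := by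
    refine ContinuousLinearMap.opNorm_le_bound _ (by positivity) fun r => ?_
    let z : PiLp 2 (fun _ : Idx n => R) := WithLp.toLp 2 fun k => x k • r
    have hz : ‖z‖ = ‖x‖ * ‖r‖ := by
      rw [PiLp.norm_eq_of_L2, EuclideanSpace.norm_eq]
      simp only [z, norm_smul, mul_pow, ← Finset.sum_mul]
      rw [Real.sqrt_mul (by positivity), Real.sqrt_sq (norm_nonneg _)]
    have hsum : (Fintype.linearCombination ℂ Q c) r = ∑ i, star (y i) • evalQ Q X z i := by
      simp only [evalQ_apply, z, Fintype.linearCombination_apply, c, sum_apply,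
        smul_apply, map_smul, Finset.smul_sum, Finset.sum_smul, Finset.mul_sum,
        smul_smul]
      rw [Finset.sum_comm]
      refine Finset.sum_congr rfl fun i _ => ?_
      rw [Finset.sum_comm]
    rw [hsum]
    calc ‖∑ i, star (y i) • evalQ Q X z i‖
        ≤ ∑ i, ‖y i‖ * ‖evalQ Q X z i‖ := by
          refine (norm_sum_le _ _).trans (le_of_eq ?_)
          exact Finset.sum_congr rfl fun i _ => by rw [norm_smul, norm_star]
      _ ≤ ‖y‖ * ‖evalQ Q X z‖ := by
          rw [PiLp.norm_eq_of_L2 (evalQ Q X z), EuclideanSpace.norm_eq y]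
          exact Real.sum_mul_le_sqrt_mul_sqrt _ _ _
      _ ≤ ‖y‖ * (1 * ‖z‖) := by
          gcongr
          exact (ContinuousLinearMap.le_opNorm _ _).trans (by gcongr)
      _ = ‖x‖ * ‖y‖ * ‖r‖ := by rw [hz]; ring
  have h2 : ‖y‖ ^ 2 ≤ K * (‖x‖ * ‖y‖) := by
    have h3 : ‖c‖ ≤ K * ‖Fintype.linearCombination ℂ Q c‖ := by
      have h4 := hK.le_mul_dist c 0
      rw [dist_zero_right, map_zero, dist_zero_right] at h4
      exact h4
    calc ‖y‖ ^ 2 = ‖c j‖ := by rw [hcj]; simp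
      _ ≤ ‖c‖ := norm_le_pi_norm c j
      _ ≤ _ := h3.trans (by gcongr)
  rcases (norm_nonneg y).eq_or_lt with h0 | h0
  · rw [← h0]; positivity
  · nlinarith

/-- The coordinate function `Z j` restricted to a subset of the operator ball. -/
def coord (Q : Fin d → R →L[ℂ] S) (hQ : LinearIndependent ℂ Q) {Ω : GradedSet d}
    (hΩ : ∀ n, Ω n ⊆ opBall Q n) (j : Fin d) : HInf Ω :=
  ⟨fun _ X => X.1 j,
    ⟨⟨fun _ _ _ _ _ => rfl, fun _ _ _ _ => rfl⟩,
      (opBall_bounded Q hQ j).imp fun _ hC n X => hC n X.1 (hΩ n X.2)⟩⟩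

/-- The tuple `π(Φ) = (Φ(Z 1), …, Φ(Z d))`. -/
def proj (Q : Fin d → R →L[ℂ] S) (hQ : LinearIndependent ℂ Q) {Ω : GradedSet d}
    (hΩ : ∀ n, Ω n ⊆ opBall Q n) {n : ℕ+} (Φ : HInf Ω →ₐ[ℂ] Mat n) : Tup d n :=
  fun j => Φ (coord Q hQ hΩ j)

/-- The common zero set in the operator ball of a family of bounded nc functions. -/
def zeroSet (Q : Fin d → R →L[ℂ] S) (T : Set (HInf (opBall Q))) : GradedSet d :=
  fun n => {X | ∃ h : X ∈ opBall Q n, ∀ F ∈ T, F.1 n ⟨X, h⟩ = 0}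

theorem zeroSet_subset (Q : Fin d → R →L[ℂ] S) (T : Set (HInf (opBall Q))) (n : ℕ+) :
    zeroSet Q T n ⊆ opBall Q n := fun _ h => h.1

/-! ### The weak-* topology -/

/-- The functional `F ↦ η(F(X))`. -/
def evalFunctional {Ω : GradedSet d} {n : ℕ+} (X : Ω n) (η : Mat n →ₗ[ℂ] ℂ) :
    HInf Ω →ₗ[ℂ] ℂ :=
  η ∘ₗ (pointEval X).toLinearMap

/-- The canonical predual: the norm closure of the linear span of the functionals
`F ↦ η(F(X))`, in the dual of `HInf Ω` with the supremum norm. -/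
def predual (Ω : GradedSet d) : Set (HInf Ω →ₗ[ℂ] ℂ) :=
  {φ | ∀ ε : ℝ≥0, 0 < ε →
    ∃ ψ ∈ Submodule.span ℂ
        {χ : HInf Ω →ₗ[ℂ] ℂ | ∃ (n : ℕ+) (X : Ω n) (η : Mat n →ₗ[ℂ] ℂ), χ = evalFunctional X η},
      ∀ F : HInf Ω, ‖φ F - ψ F‖ₑ ≤ ε * supNorm F.1}

/-- The weak-* topology: the weakest topology making every element of the predual continuous. -/
@[reducible]
def weakStar (Ω : GradedSet d) : TopologicalSpace (HInf Ω) :=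
  TopologicalSpace.induced (fun F (φ : predual Ω) => φ.1 F) inferInstance

/-! ### Right regularity -/

/-- `X^w = X (w 1) * ⋯ * X (w N)`. -/
def wordEval {n : ℕ+} {N : ℕ} (X : Tup d n) (w : Fin N → Fin d) : Mat n :=
  (List.ofFn fun l => X (w l)).prod

/-- The weak-* closed two-sided ideal generated by the monomials of length `N`. -/
def monomialIdeal (Q : Fin d → R →L[ℂ] S) (N : ℕ) : Set (HInf (opBall Q)) :=
  {f | ∀ I : TwoSidedIdeal (HInf (opBall Q)),
    @IsClosed _ (weakStar (opBall Q)) (I : Set (HInf (opBall Q))) →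
    (∀ (w : Fin N → Fin d) (F : HInf (opBall Q)),
      (∀ (n : ℕ+) (X : opBall Q n), F.1 n X = wordEval X.1 w) → F ∈ I) →
    f ∈ I}

/-- The tuple of block upper bidiagonal matrices with diagonal blocks `0, …, 0, X` and
superdiagonal blocks `t H₁, …, t H_N`, where `H_l` is the tuple with `I` in coordinate `w l` and
`0` in all others. -/
def bidiag {N : ℕ} {n : ℕ+} (t : ℝ) (w : Fin N → Fin d) (X : Tup d n) :
    Tup d (N.succPNat * n) :=
  fun j => Matrix.reindex (blockEquiv N n) (blockEquiv N n)
    (Matrix.of fun (p q : Fin (N + 1) × Idx n) =>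
      (if p.1 = Fin.last N ∧ q.1 = Fin.last N then X j p.2 q.2 else 0) +
      (if ∃ l : Fin N, p.1 = l.castSucc ∧ q.1 = l.succ ∧ w l = j
        then (t : ℂ) * (1 : Mat n) p.2 q.2 else 0))

theorem exists_bidiag_mem (Q : Fin d → R →L[ℂ] S) {N : ℕ} {n : ℕ+} (w : Fin N → Fin d)
    (X : opBall Q n) : ∃ t : ℝ, 0 < t ∧ bidiag t w X.1 ∈ opBall Q (N.succPNat * n) := by
  have hX : ‖evalQ Q X.1‖ < 1 := X.2
  let A : Tup d (N.succPNat * n) := bidiag 0 w X.1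
  let B : Tup d (N.succPNat * n) := bidiag 1 w 0
  have hAB : ∀ t : ℝ, evalQ Q (bidiag t w X.1) = evalQ Q A + (t : ℂ) • evalQ Q B := by
    intro t
    have h1 : ∀ j i k, bidiag t w X.1 j i k = A j i k + t * B j i k := by
      intro j i k
      simp [A, B, bidiag, Matrix.submatrix_apply]
    ext x i
    simp only [add_apply, smul_apply, PiLp.add_apply,
      PiLp.smul_apply, evalQ_apply, h1, add_smul, mul_smul, Finset.sum_add_distrib,
      Finset.smul_sum]
  have hA : ‖evalQ Q A‖ ≤ ‖evalQ Q X.1‖ := by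
    refine ContinuousLinearMap.opNorm_le_bound _ (norm_nonneg (evalQ Q X.1)) fun x => ?_
    let e := blockEquiv N n
    let z : PiLp 2 (fun _ : Idx n => R) := WithLp.toLp 2 fun k => x (e (Fin.last N, k))
    have hval : ∀ p : Fin (N + 1) × Idx n,
        evalQ Q A x (e p) = if p.1 = Fin.last N then evalQ Q X.1 z p.2 else 0 := by
      intro p
      have hAe : ∀ j q, A j (e p) (e q)
          = if p.1 = Fin.last N ∧ q.1 = Fin.last N then X.1 j p.2 q.2 else 0 := by
        intro j q
        simp [A, bidiag, e]
      rw [evalQ_apply, ← e.sum_comp, Fintype.sum_prod_type, Finset.sum_eq_single (Fin.last N)]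
      · simp only [hAe, evalQ_apply, z, and_true]
        split_ifs <;> simp
      · intro a _ ha
        simp [hAe, ha]
      · simp
    have hz : ‖z‖ ≤ ‖x‖ := by
      rw [PiLp.norm_eq_of_L2, PiLp.norm_eq_of_L2]
      refine Real.sqrt_le_sqrt ?_
      rw [← e.sum_comp, Fintype.sum_prod_type]
      exact Finset.single_le_sum (f := fun a => ∑ i, ‖x (e (a, i))‖ ^ 2)
        (fun a _ => by positivity) (Finset.mem_univ (Fin.last N))
    have hn : ‖evalQ Q A x‖ = ‖evalQ Q X.1 z‖ := by
      rw [PiLp.norm_eq_of_L2, PiLp.norm_eq_of_L2]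
      congr 1
      rw [← e.sum_comp, Fintype.sum_prod_type, Finset.sum_eq_single (Fin.last N)]
      · simp [hval]
      · intro a _ ha
        simp [hval, ha]
      · simp
    rw [hn]
    exact (ContinuousLinearMap.le_opNorm _ _).trans (by gcongr)
  have hpos : 0 < 1 - ‖evalQ Q X.1‖ := by linarith
  have hb : 0 < 1 + ‖evalQ Q B‖ := by positivity
  refine ⟨(1 - ‖evalQ Q X.1‖) / (1 + ‖evalQ Q B‖), by positivity, ?_⟩
  set t : ℝ := (1 - ‖evalQ Q X.1‖) / (1 + ‖evalQ Q B‖) with ht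
  have ht0 : 0 < t := by positivity
  have htm : t * (1 + ‖evalQ Q B‖) = 1 - ‖evalQ Q X.1‖ := div_mul_cancel₀ _ hb.ne'
  change ‖evalQ Q (bidiag t w X.1)‖ < 1
  rw [hAB]
  refine (norm_add_le (evalQ Q A) ((t : ℂ) • evalQ Q B)).trans_lt ?_
  have h1 : ‖(t : ℂ) • evalQ Q B‖ ≤ ‖(t : ℂ)‖ * ‖evalQ Q B‖ :=
    ContinuousLinearMap.opNorm_smul_le _ _
  rw [Complex.norm_real, Real.norm_of_nonneg ht0.le] at h1
  linarith

/-- The nc difference-differential `Δ^w f(0, …, 0, X)`: the upper right `n × n` block of the value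
of `f` at `bidiag t w X`, divided by `t ^ N`, where `t > 0` is any number for which that point lies
in the domain (for an nc function `f` the result does not depend on `t`). -/
def deltaWord (Q : Fin d → R →L[ℂ] S) {N : ℕ} (w : Fin N → Fin d) (f : GradedFun (opBall Q)) :
    GradedFun (opBall Q) :=
  fun n X => Matrix.of fun i k =>
    (((exists_bidiag_mem Q w X).choose : ℂ) ^ N)⁻¹ *
      f (N.succPNat * n) ⟨_, (exists_bidiag_mem Q w X).choose_spec.2⟩
        (blockEquiv N n (0, i)) (blockEquiv N n (Fin.last N, k))

/-- The row of the square matrices `A w`. -/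
def rowMat {ι : Type} {n : ℕ+} (A : ι → Mat n) : Matrix (Idx n) (ι × Idx n) ℂ :=
  Matrix.of fun i p => A p.1 i p.2

/-- The column of the square matrices `A w`. -/
def colMat {ι : Type} {n : ℕ+} (A : ι → Mat n) : Matrix (ι × Idx n) (Idx n) ℂ :=
  Matrix.of fun p k => A p.1 p.2 k

/-- Right regularity of an operator ball. -/
def IsRightRegular (Q : Fin d → R →L[ℂ] S) : Prop :=
  (∀ f ∈ HInf (opBall Q), ∀ (N : ℕ) (w : Fin N → Fin d), deltaWord Q w f ∈ HInf (opBall Q)) ∧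
  ∃ M : ℝ≥0, ∀ (N : ℕ), ∀ f ∈ monomialIdeal Q N,
    supNorm (Ω := opBall Q) (fun _ X => rowMat fun w : Fin N → Fin d => wordEval X.1 w) *
      supNorm (Ω := opBall Q) (fun n X => colMat fun w : Fin N → Fin d => deltaWord Q w f.1 n X)
      ≤ M * supNorm f.1

end Ball

end NCBall

end

/-!
Let `Φ` be a completely contractive representation of the bounded nc functions on the ball, with
`π(Φ) = X` in the ball.

*The ball.* Everything about nc functions is drawn from one fact (`IsNC.intertwine`): if
`A_j L = L B_j` for all `j`, then `F(A) L = L F(B)`. It gives the Taylor expansion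
`f = ∑_{|w| < N} c_w Z^w + ∑_{|w| = N} Z^w Δ^w f` (`taylor_expansion`) without any analyticity, and
it shows that the homogeneous component of degree `k` of `f` at `X` is a block of the value of `f`
at `X ⊗ S`, where `S` is a nilpotent shift, so that its norm is at most `‖f‖` (`norm_homPart_le`).
Hence the remainder `r_N = ∑_{|w| = N} Z^w Δ^w f` has norm at most `(N + 1) ‖f‖`, and it lies in the
monomial ideal of order `N`. Write `X = s Y` with `Y` in the ball and `s < 1`. Then
`Φ(r_N) = ∑ X^w Φ(Δ^w f)` is the product of the row `s ^ N (Y^w)` and the column `(Φ(Δ^w f))`.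
Complete contractivity bounds the column by its supremum over the ball, and right regularity then
gives `‖Φ(r_N)‖ ≤ s ^ N M (N + 1) ‖f‖ → 0`. So `Φ(f)` is the limit of the values at `X` of the Taylor
polynomials of `f`, whatever `Φ` is (`IsRightRegular.eq_of_proj_eq`).

*Subvarieties.* It suffices that every bounded nc function `F` on a subvariety extends to a bounded
nc function on the ball (`exists_extension`), because `Φ` composed with the restriction map is a
completely contractive representation for the ball. By compactness the extension reduces to
finding, for one point `Y` of the variety and one point `X` of the ball, a polynomial `p` with
`p(Y) = F(Y)` and `‖p(X)‖ ≤ C + 1`, where `C` bounds `F` (`exists_interpolating_poly`). Values of nc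
functions are polynomials in the point (`IsHereditary.exists_polyEval_eq`), so `F(Y) = p₀(Y)` for
some `p₀`. By Hahn–Banach the distance from `p₀(X)` to `{q(X) : q(Y) = 0}` is the value of a
contractive functional annihilating these `q(X)`. Such a functional is a vector functional on an
amplification of `X`, and it factors through the compression `W` of the amplification to a
semi-invariant subspace on which all `q` with `q(Y) = 0` vanish. Then `W` lies in the variety and
`p₀(W) = F(W)`, so the distance is at most `C` (`norm_functional_le`).
-/

noncomputable section

universe u v

namespace NCBall

/-! ### Norm estimates for matrix amplifications and for `evalQ` -/

/-- The amplification `V ⊗ 1` of a scalar matrix to a Hilbert space has norm at most `‖V‖`: expand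
the vectors `z k` in an orthonormal basis of their span. -/
theorem norm_amplification_le {H : Type*} [NormedAddCommGroup H] [InnerProductSpace ℂ H]
    {ι κ : Type*} [Fintype ι] [Fintype κ] [DecidableEq ι] (V : Matrix κ ι ℂ)
    (z : PiLp 2 fun _ : ι => H) :
    ‖(WithLp.toLp 2 fun i => ∑ k, V i k • z k : PiLp 2 fun _ : κ => H)‖ ≤ ‖V‖ * ‖z‖ := by
  let E : Submodule ℂ H := Submodule.span ℂ (Set.range fun k => z k)
  have : FiniteDimensional ℂ E := FiniteDimensional.span_of_finite ℂ (Set.finite_range _)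
  let b := stdOrthonormalBasis ℂ E
  let y : ι → E := fun k => ⟨z k, Submodule.subset_span ⟨k, rfl⟩⟩
  let c : Fin (Module.finrank ℂ E) → EuclideanSpace ℂ ι :=
    fun r => WithLp.toLp 2 fun k => inner ℂ (b r) (y k)
  have hy : ∀ k, ‖z k‖ ^ 2 = ∑ r, ‖c r k‖ ^ 2 := fun k => by
    rw [show ‖z k‖ = ‖y k‖ from rfl, ← b.sum_sq_norm_inner_right]
  have hv : ∀ i, ‖∑ k, V i k • z k‖ ^ 2
      = ∑ r, ‖(WithLp.toLp 2 (V.mulVec (c r)) : EuclideanSpace ℂ κ) i‖ ^ 2 := fun i => by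
    have h1 : ∑ k, V i k • z k = ((∑ k, V i k • y k : E) : H) := by simp [y]
    have h2 : ‖∑ k, V i k • z k‖ = ‖(∑ k, V i k • y k : E)‖ := by rw [h1]; rfl
    rw [h2, ← b.sum_sq_norm_inner_right]
    refine Finset.sum_congr rfl fun r _ => ?_
    congr 2
    simp [inner_sum, inner_smul_right, Matrix.mulVec, dotProduct, c]
  have hsq : ‖(WithLp.toLp 2 fun i => ∑ k, V i k • z k : PiLp 2 fun _ : κ => H)‖ ^ 2
      ≤ (‖V‖ * ‖z‖) ^ 2 := by
    rw [PiLp.norm_sq_eq_of_L2, mul_pow, PiLp.norm_sq_eq_of_L2]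
    have e1 := Finset.sum_congr rfl fun i (_ : i ∈ Finset.univ) => hv i
    have e2 := Finset.sum_congr rfl fun k (_ : k ∈ Finset.univ) => hy k
    rw [Finset.sum_comm] at e1 e2
    rw [e2, Finset.mul_sum]
    refine e1.trans_le (Finset.sum_le_sum fun r _ => ?_)
    have h := Matrix.l2_opNorm_mulVec V (c r)
    rw [← EuclideanSpace.norm_sq_eq, ← EuclideanSpace.norm_sq_eq, ← mul_pow]
    gcongr
    exact h
  exact abs_le_of_sq_le_sq' hsq (by positivity) |>.2

theorem norm_le_one_of_conjTranspose_mul_self {ι κ : Type*} [Fintype ι] [Fintype κ]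
    [DecidableEq κ] [DecidableEq ι] {V : Matrix ι κ ℂ} (hV : V.conjTranspose * V = 1) :
    ‖V‖ ≤ 1 := by
  have h := Matrix.l2_opNorm_conjTranspose_mul_self V
  rw [hV] at h
  have h1 : ‖(1 : Matrix κ κ ℂ)‖ ≤ 1 := by
    rw [← Matrix.diagonal_one, Matrix.l2_opNorm_diagonal]
    exact (pi_norm_le_iff_of_nonneg zero_le_one).2 fun i => by simp
  nlinarith [norm_nonneg V]

theorem norm_conjTranspose_le_one {ι κ : Type*} [Fintype ι] [Fintype κ]
    [DecidableEq κ] [DecidableEq ι] {V : Matrix ι κ ℂ} (hV : V.conjTranspose * V = 1) :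
    ‖V.conjTranspose‖ ≤ 1 := by
  rw [Matrix.l2_opNorm_conjTranspose]
  exact norm_le_one_of_conjTranspose_mul_self hV

theorem norm_submatrix_le {ι κ ι' κ' : Type} [Fintype ι] [Fintype κ] [Fintype ι'] [Fintype κ']
    [DecidableEq ι] [DecidableEq κ] [DecidableEq ι'] [DecidableEq κ'] (M : Matrix ι κ ℂ)
    {σ : ι' → ι} {σ' : κ' → κ} (hσ : Function.Injective σ) (hσ' : Function.Injective σ') :
    ‖M.submatrix σ σ'‖ ≤ ‖M‖ := by
  let V : Matrix ι ι' ℂ := Matrix.of fun i c => if i = σ c then 1 else 0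
  let W : Matrix κ κ' ℂ := Matrix.of fun i c => if i = σ' c then 1 else 0
  have hV : V.conjTranspose * V = 1 := by
    ext a b
    simp [V, Matrix.mul_apply, Matrix.one_apply, hσ.eq_iff, eq_comm]
  have hW : W.conjTranspose * W = 1 := by
    ext a b
    simp [W, Matrix.mul_apply, Matrix.one_apply, hσ'.eq_iff, eq_comm]
  have h : M.submatrix σ σ' = V.conjTranspose * M * W := by
    ext a b
    simp [V, W, Matrix.mul_apply]
  rw [h]
  calc _ ≤ ‖V.conjTranspose‖ * ‖M‖ * ‖W‖ :=
        (Matrix.l2_opNorm_mul _ _).trans (by gcongr; exact Matrix.l2_opNorm_mul _ _)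
    _ ≤ 1 * ‖M‖ * 1 := by
        gcongr
        · exact norm_conjTranspose_le_one hV
        · exact norm_le_one_of_conjTranspose_mul_self hW
    _ = _ := by ring

section Ball

variable {d : ℕ} {R : Type u} {S : Type v}
  [NormedAddCommGroup R] [InnerProductSpace ℂ R]
  [NormedAddCommGroup S] [InnerProductSpace ℂ S] (Q : Fin d → R →L[ℂ] S)

theorem norm_evalQ_mul_mul_le {ι κ : Type} [Fintype ι] [Fintype κ]
    [DecidableEq ι] [DecidableEq κ]
    (V W : Matrix κ ι ℂ) (X : Fin d → Matrix ι ι ℂ) :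
    ‖evalQ Q fun j => V * X j * W.conjTranspose‖ ≤ ‖V‖ * ‖evalQ Q X‖ * ‖W.conjTranspose‖ := by
  refine ContinuousLinearMap.opNorm_le_bound _ (by positivity) fun z => ?_
  let z' : PiLp 2 fun _ : ι => R := WithLp.toLp 2 fun i => ∑ k, W.conjTranspose i k • z k
  have h : evalQ Q (fun j => V * X j * W.conjTranspose) z
      = WithLp.toLp 2 fun i => ∑ k, V i k • evalQ Q X z' k := by
    ext i
    simp only [evalQ_apply, z', Matrix.mul_apply, Finset.sum_mul, Finset.sum_smul, map_sum,
      map_smul, Finset.smul_sum, smul_smul]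
    calc ∑ k, ∑ j, ∑ b, ∑ a, (V i a * X j a b * W.conjTranspose b k) • Q j (z k)
        = ∑ k, ∑ j, ∑ a, ∑ b, (V i a * X j a b * W.conjTranspose b k) • Q j (z k) :=
          Finset.sum_congr rfl fun k _ => Finset.sum_congr rfl fun j _ => Finset.sum_comm
      _ = ∑ k, ∑ a, ∑ j, ∑ b, (V i a * X j a b * W.conjTranspose b k) • Q j (z k) :=
          Finset.sum_congr rfl fun k _ => Finset.sum_comm
      _ = ∑ a, ∑ k, ∑ j, ∑ b, (V i a * X j a b * W.conjTranspose b k) • Q j (z k) :=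
          Finset.sum_comm
      _ = ∑ a, ∑ b, ∑ j, ∑ k, (V i a * (X j a b * W.conjTranspose b k)) • Q j (z k) := by
          refine Finset.sum_congr rfl fun a _ => ?_
          simp only [mul_assoc]
          rw [Finset.sum_comm, Finset.sum_comm (s := Finset.univ (α := ι))]
          refine Finset.sum_congr rfl fun j _ => ?_
          rw [Finset.sum_comm]
  rw [h]
  calc _ ≤ ‖V‖ * ‖evalQ Q X z'‖ := norm_amplification_le V _
    _ ≤ ‖V‖ * (‖evalQ Q X‖ * (‖W.conjTranspose‖ * ‖z‖)) := by
        gcongr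
        refine (ContinuousLinearMap.le_opNorm _ _).trans ?_
        gcongr
        exact norm_amplification_le _ _
    _ = _ := by ring

/-- Compression to, and extension by zero along, isometries do not increase the norm of `Q(X)`. -/
theorem norm_evalQ_extend_le {ι κ : Type} [Fintype ι] [Fintype κ]
    [DecidableEq ι] [DecidableEq κ] {V W : Matrix κ ι ℂ} (hV : V.conjTranspose * V = 1)
    (hW : W.conjTranspose * W = 1) (X : Fin d → Matrix ι ι ℂ) :
    ‖evalQ Q fun j => V * X j * W.conjTranspose‖ ≤ ‖evalQ Q X‖ := by
  refine (norm_evalQ_mul_mul_le Q V W X).trans ?_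
  have h1 := norm_le_one_of_conjTranspose_mul_self hV
  have h2 := norm_conjTranspose_le_one hW
  calc _ ≤ 1 * ‖evalQ Q X‖ * 1 := by gcongr
    _ = _ := by ring

theorem norm_evalQ_compress_le {ι κ : Type} [Fintype ι] [Fintype κ]
    [DecidableEq ι] [DecidableEq κ] {V : Matrix κ ι ℂ} (hV : V.conjTranspose * V = 1)
    (X : Fin d → Matrix κ κ ℂ) :
    ‖evalQ Q fun j => V.conjTranspose * X j * V‖ ≤ ‖evalQ Q X‖ := by
  have h := norm_evalQ_mul_mul_le Q V.conjTranspose V.conjTranspose X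
  rw [Matrix.conjTranspose_conjTranspose] at h
  refine h.trans ?_
  have h1 := norm_le_one_of_conjTranspose_mul_self hV
  have h2 := norm_conjTranspose_le_one hV
  calc _ ≤ 1 * ‖evalQ Q X‖ * 1 := by gcongr
    _ = _ := by ring

theorem norm_evalQ_reindex_le {ι κ : Type} [Fintype ι] [Fintype κ] (e : ι ≃ κ)
    (X : Fin d → Matrix ι ι ℂ) :
    ‖evalQ Q fun j => Matrix.reindex e e (X j)‖ ≤ ‖evalQ Q X‖ := by
  refine ContinuousLinearMap.opNorm_le_bound _ (norm_nonneg (evalQ Q X)) fun z => ?_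
  let z' : PiLp 2 fun _ : ι => R := WithLp.toLp 2 fun i => z (e i)
  have hz : ‖z'‖ = ‖z‖ := by
    rw [PiLp.norm_eq_of_L2, PiLp.norm_eq_of_L2, ← e.sum_comp]
  have h : ‖evalQ Q (fun j => Matrix.reindex e e (X j)) z‖ = ‖evalQ Q X z'‖ := by
    rw [PiLp.norm_eq_of_L2, PiLp.norm_eq_of_L2, ← e.sum_comp]
    congr 1
    refine Finset.sum_congr rfl fun i _ => ?_
    rw [evalQ_apply, evalQ_apply, ← e.sum_comp]
    simp [z']
  rw [h, ← hz]
  exact ContinuousLinearMap.le_opNorm _ _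

theorem norm_evalQ_fromBlocks_le {ι κ : Type} [Fintype ι] [Fintype κ]
    (X : Fin d → Matrix ι ι ℂ) (Y : Fin d → Matrix κ κ ℂ) :
    ‖evalQ Q fun j => Matrix.fromBlocks (X j) 0 0 (Y j)‖ ≤ max ‖evalQ Q X‖ ‖evalQ Q Y‖ := by
  set C := max ‖evalQ Q X‖ ‖evalQ Q Y‖ with hC
  have hC0 : 0 ≤ C := (norm_nonneg (evalQ Q X)).trans (le_max_left _ _)
  refine ContinuousLinearMap.opNorm_le_bound _ hC0 fun z => ?_
  let x : PiLp 2 fun _ : ι => R := WithLp.toLp 2 fun i => z (Sum.inl i)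
  let y : PiLp 2 fun _ : κ => R := WithLp.toLp 2 fun i => z (Sum.inr i)
  have hz : ‖z‖ ^ 2 = ‖x‖ ^ 2 + ‖y‖ ^ 2 := by
    simp only [PiLp.norm_sq_eq_of_L2, Fintype.sum_sum_type]
    rfl
  have hv : ‖evalQ Q (fun j => Matrix.fromBlocks (X j) 0 0 (Y j)) z‖ ^ 2
      = ‖evalQ Q X x‖ ^ 2 + ‖evalQ Q Y y‖ ^ 2 := by
    simp only [PiLp.norm_sq_eq_of_L2, Fintype.sum_sum_type, evalQ_apply]
    simp [x, y]
  have h1 : ‖evalQ Q X x‖ ≤ C * ‖x‖ :=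
    (ContinuousLinearMap.le_opNorm _ _).trans (by gcongr; exact le_max_left _ _)
  have h2 : ‖evalQ Q Y y‖ ≤ C * ‖y‖ :=
    (ContinuousLinearMap.le_opNorm _ _).trans (by gcongr; exact le_max_right _ _)
  refine abs_le_of_sq_le_sq' ?_ (by positivity) |>.2
  rw [hv, mul_pow, hz]
  have h3 := pow_le_pow_left₀ (norm_nonneg _) h1 2
  have h4 := pow_le_pow_left₀ (norm_nonneg _) h2 2
  linarith [mul_pow C ‖x‖ 2, mul_pow C ‖y‖ 2, mul_add (C ^ 2) (‖x‖ ^ 2) (‖y‖ ^ 2)]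

open scoped Kronecker in
theorem norm_evalQ_one_kronecker_le {α ι : Type} [Fintype α] [Fintype ι] [DecidableEq α]
    (X : Fin d → Matrix ι ι ℂ) :
    ‖evalQ Q fun j => (1 : Matrix α α ℂ) ⊗ₖ X j‖ ≤ ‖evalQ Q X‖ := by
  refine ContinuousLinearMap.opNorm_le_bound _ (norm_nonneg (evalQ Q X)) fun z => ?_
  let x : α → PiLp 2 fun _ : ι => R := fun a => WithLp.toLp 2 fun i => z (a, i)
  have hz : ‖z‖ ^ 2 = ∑ a, ‖x a‖ ^ 2 := by
    simp only [PiLp.norm_sq_eq_of_L2, Fintype.sum_prod_type]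
    rfl
  have hv : ‖evalQ Q (fun j => (1 : Matrix α α ℂ) ⊗ₖ X j) z‖ ^ 2
      = ∑ a, ‖evalQ Q X (x a)‖ ^ 2 := by
    simp only [PiLp.norm_sq_eq_of_L2, Fintype.sum_prod_type]
    refine Finset.sum_congr rfl fun a _ => Finset.sum_congr rfl fun i _ => ?_
    congr 2
    rw [evalQ_apply, evalQ_apply, Fintype.sum_prod_type, Finset.sum_eq_single a]
    · simp [x]
    · intro b _ hb
      simp [Matrix.one_apply_ne hb.symm]
    · simp
  refine abs_le_of_sq_le_sq' ?_ (by positivity) |>.2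
  rw [hv, mul_pow, hz, Finset.mul_sum]
  refine Finset.sum_le_sum fun a _ => ?_
  rw [← mul_pow]
  gcongr
  exact ContinuousLinearMap.le_opNorm _ _

theorem evalQ_add_smul {ι : Type} [Fintype ι] (A B : Fin d → Matrix ι ι ℂ) (t : ℂ) :
    evalQ Q (fun j => A j + t • B j) = evalQ Q A + t • evalQ Q B := by
  ext x i
  simp only [add_apply, smul_apply, PiLp.add_apply, PiLp.smul_apply, evalQ_apply,
    Matrix.add_apply, Matrix.smul_apply, smul_eq_mul, add_smul, mul_smul,
    Finset.sum_add_distrib, Finset.smul_sum]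

theorem evalQ_smul {ι : Type} [Fintype ι] (A : Fin d → Matrix ι ι ℂ) (t : ℂ) :
    evalQ Q (fun j => t • A j) = t • evalQ Q A := by
  ext x i
  simp only [smul_apply, PiLp.smul_apply, evalQ_apply,
    Matrix.smul_apply, smul_eq_mul, mul_smul, Finset.smul_sum]

theorem exists_pos_norm_evalQ_add_smul_lt {ι : Type} [Fintype ι] (A B : Fin d → Matrix ι ι ℂ)
    (hA : ‖evalQ Q A‖ < 1) : ∃ t : ℝ, 0 < t ∧ ‖evalQ Q fun j => A j + (t : ℂ) • B j‖ < 1 := by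
  have hb : 0 < 1 + ‖evalQ Q B‖ := by positivity
  have hpos : 0 < 1 - ‖evalQ Q A‖ := by linarith
  refine ⟨(1 - ‖evalQ Q A‖) / (1 + ‖evalQ Q B‖), by positivity, ?_⟩
  set t : ℝ := (1 - ‖evalQ Q A‖) / (1 + ‖evalQ Q B‖) with ht
  have ht0 : 0 < t := by positivity
  have htm : t * (1 + ‖evalQ Q B‖) = 1 - ‖evalQ Q A‖ := div_mul_cancel₀ _ hb.ne'
  rw [evalQ_add_smul]
  refine (norm_add_le (evalQ Q A) ((t : ℂ) • evalQ Q B)).trans_lt ?_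
  have h1 : ‖(t : ℂ) • evalQ Q B‖ ≤ ‖(t : ℂ)‖ * ‖evalQ Q B‖ :=
    ContinuousLinearMap.opNorm_smul_le _ _
  rw [Complex.norm_real, Real.norm_of_nonneg ht0.le] at h1
  linarith

end Ball

/-! ### Intertwining property of nc functions -/

/-- A graded set is closed under direct sums. -/
def DsumClosed {d : ℕ} (Ω : GradedSet d) : Prop :=
  ∀ ⦃m n : ℕ+⦄ ⦃X : Tup d m⦄ ⦃Y : Tup d n⦄, X ∈ Ω m → Y ∈ Ω n → dsumTup X Y ∈ Ω (m + n)

/-- A tuple of matrices over an arbitrary index type, relabelled as a point of the nc universe. -/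
def relabel {d : ℕ} {ι : Type} {n : ℕ+} (e : ι ≃ Idx n) (A : Fin d → Matrix ι ι ℂ) : Tup d n :=
  fun j => Matrix.reindex e e (A j)

theorem exists_equiv_Idx (ι : Type) [Fintype ι] [Nonempty ι] :
    ∃ n : ℕ+, Nonempty (ι ≃ Idx n) :=
  ⟨⟨Fintype.card ι, Fintype.card_pos⟩, ⟨Fintype.equivFin ι⟩⟩

/-- An nc function on a set closed under direct sums respects all intertwiners `A L = L B`, because
the similarity by `[1 L; 0 1]` fixes the direct sum of `A` and `B`. -/
theorem IsNC.intertwine {d : ℕ} {Ω : GradedSet d} (hΩ : DsumClosed Ω) {F : GradedFun Ω}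
    (hF : IsNC F) {m n : ℕ+} (A : Ω m) (B : Ω n) (L : Matrix (Idx m) (Idx n) ℂ)
    (h : ∀ j, A.1 j * L = L * B.1 j) : F m A * L = L * F n B := by
  let φ := Matrix.reindexAlgEquiv ℂ ℂ (sumEquiv m n)
  have hd : ∀ (X : Mat m) (Y : Mat n), dsum X Y = φ (Matrix.fromBlocks X 0 0 Y) := fun _ _ => rfl
  let S : (Mat (m + n))ˣ :=
    { val := φ (Matrix.fromBlocks 1 L 0 1)
      inv := φ (Matrix.fromBlocks 1 (-L) 0 1)
      val_inv := by rw [← map_mul, Matrix.fromBlocks_multiply]; simp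
      inv_val := by rw [← map_mul, Matrix.fromBlocks_multiply]; simp }
  have hS : (S : Mat (m + n)) = φ (Matrix.fromBlocks 1 L 0 1) := rfl
  have hcomm : ∀ j, dsumTup A.1 B.1 j * (S : Mat (m + n)) = S * dsumTup A.1 B.1 j := fun j => by
    rw [dsumTup, hd, hS, ← map_mul, ← map_mul, Matrix.fromBlocks_multiply,
      Matrix.fromBlocks_multiply]
    simp [h]
  have hconj : conjTup S (dsumTup A.1 B.1) = dsumTup A.1 B.1 := by
    funext j
    rw [conjTup, mul_assoc, hcomm, Units.inv_mul_cancel_left]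
  have hmem := hΩ A.2 B.2
  have h1 := hF.map_conj (m + n) S ⟨_, hmem⟩ (by rw [hconj]; exact hmem)
  simp only [hconj] at h1
  rw [mul_assoc, Units.eq_inv_mul_iff_mul_eq, hF.map_dsum, hd, hS, ← map_mul, ← map_mul,
    Matrix.fromBlocks_multiply, Matrix.fromBlocks_multiply] at h1
  have h2 := (Matrix.fromBlocks_inj.1 (φ.injective h1)).2.1
  simpa using h2.symm

theorem IsNC.intertwine_relabel {d : ℕ} {Ω : GradedSet d} (hΩ : DsumClosed Ω) {F : GradedFun Ω}
    (hF : IsNC F) {m n : ℕ+} {ι κ : Type} [Fintype ι] [Fintype κ]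
    (e : ι ≃ Idx m) (e' : κ ≃ Idx n)
    (A : Fin d → Matrix ι ι ℂ) (B : Fin d → Matrix κ κ ℂ) (hA : relabel e A ∈ Ω m)
    (hB : relabel e' B ∈ Ω n) (L : Matrix ι κ ℂ) (h : ∀ j, A j * L = L * B j) :
    (F m ⟨_, hA⟩).submatrix e e * L = L * (F n ⟨_, hB⟩).submatrix e' e' := by
  have h1 := hF.intertwine hΩ ⟨_, hA⟩ ⟨_, hB⟩ (Matrix.reindex e e' L) fun j => by
    simp only [relabel, Matrix.reindex_apply, Matrix.submatrix_mul_equiv, h]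
  have h2 := congrArg (fun M => Matrix.submatrix M e e') h1
  simp only [Matrix.reindex_apply] at h2
  rw [← Matrix.submatrix_mul_equiv _ _ e e e', ← Matrix.submatrix_mul_equiv _ _ e e' e'] at h2
  simpa using h2

/-- If `B` is, up to the diagonal weights `α`, the corner of `A` on the indices `σ`, and the
complementary coordinates span an invariant subspace for `A`, then `F(B)` is the weighted corner
of `F(A)`. -/
theorem IsNC.corner {d : ℕ} {Ω : GradedSet d} (hΩ : DsumClosed Ω) {F : GradedFun Ω}
    (hF : IsNC F) {m n : ℕ+} {ι κ : Type} [Fintype ι] [Fintype κ]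
    (e : ι ≃ Idx m) (e' : κ ≃ Idx n)
    (A : Fin d → Matrix ι ι ℂ) (B : Fin d → Matrix κ κ ℂ) (hA : relabel e A ∈ Ω m)
    (hB : relabel e' B ∈ Ω n) (σ : κ → ι) (hσ : Function.Injective σ) (α : κ → ℂ)
    (h : ∀ j c c', B j c c' * α c' = α c * A j (σ c) (σ c'))
    (h0 : ∀ j c s, s ∉ Set.range σ → A j (σ c) s = 0) (c c' : κ) :
    F n ⟨_, hB⟩ (e' c) (e' c') * α c' = α c * F m ⟨_, hA⟩ (e (σ c)) (e (σ c')) := by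
  classical
  let K : Matrix κ ι ℂ := Matrix.of fun c s => if s = σ c then α c else 0
  have hl : ∀ (M : Matrix κ κ ℂ) (c c' : κ), (M * K) c (σ c') = M c c' * α c' := fun M c c' => by
    rw [Matrix.mul_apply, Finset.sum_eq_single c']
    · simp [K]
    · intro b _ hb
      simp [K, hσ.ne hb.symm]
    · simp
  have hr : ∀ (M : Matrix ι ι ℂ) (c : κ) (s : ι), (K * M) c s = α c * M (σ c) s := fun M c s => by
    rw [Matrix.mul_apply, Finset.sum_eq_single (σ c)]
    · simp [K]
    · intro b _ hb
      simp [K, hb]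
    · simp
  have key := hF.intertwine_relabel hΩ e' e B A hB hA K fun j => by
    ext c s
    rw [hr]
    by_cases hs : s ∈ Set.range σ
    · obtain ⟨c', rfl⟩ := hs
      rw [hl, h]
    · rw [h0 j c s hs, mul_zero, Matrix.mul_apply]
      refine Finset.sum_eq_zero fun b _ => ?_
      have : s ≠ σ b := fun hb => hs ⟨b, hb.symm⟩
      simp [K, this]
  have := congrFun (congrFun key c) (σ c')
  rwa [hl, hr] at this

/-- A graded function that respects intertwiners is an nc function. -/
theorem IsNC.of_intertwine {d : ℕ} {Ω : GradedSet d} {F : GradedFun Ω}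
    (h : ∀ (m n : ℕ+) (A : Ω m) (B : Ω n) (L : Matrix (Idx m) (Idx n) ℂ),
      (∀ j, A.1 j * L = L * B.1 j) → F m A * L = L * F n B) : IsNC F where
  map_dsum m n X Y hXY := by
    let e := sumEquiv m n
    let D := F (m + n) ⟨_, hXY⟩
    have h1 := h (m + n) m ⟨_, hXY⟩ X
      ((Matrix.fromRows 1 0 : Matrix (Idx m ⊕ Idx n) (Idx m) ℂ).submatrix e.symm id) fun j => by
        simp only [dsumTup, dsum, Matrix.reindex_apply]
        ext i k
        obtain ⟨i, rfl⟩ := e.surjective i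
        simp only [Matrix.mul_apply, Matrix.submatrix_apply, ← e.sum_comp, Fintype.sum_sum_type]
        rcases i with i | i <;> simp [e, Matrix.one_apply]
    have h2 := h (m + n) n ⟨_, hXY⟩ Y
      ((Matrix.fromRows 0 1 : Matrix (Idx m ⊕ Idx n) (Idx n) ℂ).submatrix e.symm id) fun j => by
        simp only [dsumTup, dsum, Matrix.reindex_apply]
        ext i k
        obtain ⟨i, rfl⟩ := e.surjective i
        simp only [Matrix.mul_apply, Matrix.submatrix_apply, ← e.sum_comp, Fintype.sum_sum_type]
        rcases i with i | i <;> simp [e, Matrix.one_apply]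
    ext i k
    obtain ⟨i, rfl⟩ := e.surjective i
    obtain ⟨k, rfl⟩ := e.surjective k
    rcases k with k | k
    · have h3 := congrFun (congrFun h1 (e i)) k
      simp only [Matrix.mul_apply, Matrix.submatrix_apply, ← e.sum_comp,
        Fintype.sum_sum_type] at h3
      rcases i with i | i <;> simpa [e, dsum, Matrix.one_apply] using h3
    · have h3 := congrFun (congrFun h2 (e i)) k
      simp only [Matrix.mul_apply, Matrix.submatrix_apply, ← e.sum_comp,
        Fintype.sum_sum_type] at h3
      rcases i with i | i <;> simpa [e, dsum, Matrix.one_apply] using h3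
  map_conj n S X hX := by
    have h1 := h n n ⟨_, hX⟩ X (↑S⁻¹ : Mat n) fun j => by
      simp only [conjTup, mul_assoc, Units.mul_inv, mul_one]
    have h2 := congrArg (· * (S : Mat n)) h1
    simpa only [mul_assoc, Units.inv_mul, mul_one] using h2

/-- The value of a noncommutative polynomial at a tuple of matrices. -/
def polyEval {d : ℕ} {ι : Type} [Fintype ι] [DecidableEq ι] (A : Fin d → Matrix ι ι ℂ) :
    FreeAlgebra ℂ (Fin d) →ₐ[ℂ] Matrix ι ι ℂ := FreeAlgebra.lift ℂ A

@[simp]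
theorem polyEval_ι {d : ℕ} {ι : Type} [Fintype ι] [DecidableEq ι] (A : Fin d → Matrix ι ι ℂ)
    (j : Fin d) : polyEval A (FreeAlgebra.ι ℂ j) = A j := by
  simp [polyEval]

theorem polyEval_intertwine {d : ℕ} {ι κ : Type} [Fintype ι] [Fintype κ] [DecidableEq ι]
    [DecidableEq κ] {A : Fin d → Matrix ι ι ℂ} {B : Fin d → Matrix κ κ ℂ} {L : Matrix ι κ ℂ}
    (h : ∀ j, A j * L = L * B j) (p : FreeAlgebra ℂ (Fin d)) :
    polyEval A p * L = L * polyEval B p := by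
  induction p using FreeAlgebra.induction with
  | grade0 r => simp [Algebra.algebraMap_eq_smul_one]
  | grade1 j => simpa using h j
  | mul a b ha hb =>
    rw [map_mul, map_mul, Matrix.mul_assoc, hb, ← Matrix.mul_assoc, ha, Matrix.mul_assoc]
  | add a b ha hb => rw [map_add, map_add, Matrix.add_mul, Matrix.mul_add, ha, hb]

section Ball

variable {d : ℕ} {R : Type u} {S : Type v}
  [NormedAddCommGroup R] [InnerProductSpace ℂ R]
  [NormedAddCommGroup S] [InnerProductSpace ℂ S] {Q : Fin d → R →L[ℂ] S}

theorem opBall_dsumClosed : DsumClosed (opBall Q) := fun m n X Y hX hY => by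
  refine (norm_evalQ_reindex_le Q (sumEquiv m n) fun j => Matrix.fromBlocks (X j) 0 0 (Y j)).trans_lt
    ((norm_evalQ_fromBlocks_le Q X Y).trans_lt (max_lt hX hY))

theorem relabel_mem_opBall {ι : Type} [Fintype ι] {n : ℕ+} (e : ι ≃ Idx n)
    {A : Fin d → Matrix ι ι ℂ} (hA : ‖evalQ Q A‖ < 1) : relabel e A ∈ opBall Q n :=
  (norm_evalQ_reindex_le Q e A).trans_lt hA

theorem zero_mem_opBall (n : ℕ+) : (0 : Tup d n) ∈ opBall Q n := by
  have h : evalQ Q (0 : Tup d n) = 0 := by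
    ext x i
    simp [evalQ_apply]
  change ‖evalQ Q (0 : Tup d n)‖ < 1
  rw [h, ContinuousLinearMap.opNorm_zero]
  exact zero_lt_one

/-! ### The Taylor expansion at the origin -/

instance : Unique (Idx 1) := inferInstanceAs (Unique (Fin 1))

/-- The scalar value of an nc function at the origin of the first level. -/
def valueAtZero (g : GradedFun (opBall Q)) : ℂ :=
  g 1 ⟨0, zero_mem_opBall 1⟩ default default

theorem IsNC.apply_zero {g : GradedFun (opBall Q)} (hg : IsNC g) (n : ℕ+) :
    g n ⟨0, zero_mem_opBall n⟩ = valueAtZero g • (1 : Mat n) := by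
  ext i k
  have h := hg.intertwine opBall_dsumClosed ⟨0, zero_mem_opBall n⟩ ⟨0, zero_mem_opBall 1⟩
    (Matrix.of fun i _ => if i = k then 1 else 0) fun j => by simp
  have h1 := congrFun (congrFun h i) default
  simpa [Matrix.mul_apply, valueAtZero, Matrix.one_apply] using h1

/-- The tuple `bidiag t w X` before the blocks are numbered consecutively. -/
def bidiagBlock {N : ℕ} {n : ℕ+} (t : ℝ) (w : Fin N → Fin d) (X : Tup d n) (j : Fin d) :
    Matrix (Fin (N + 1) × Idx n) (Fin (N + 1) × Idx n) ℂ :=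
  Matrix.of fun p q =>
    (if p.1 = Fin.last N ∧ q.1 = Fin.last N then X j p.2 q.2 else 0) +
      (if ∃ l : Fin N, p.1 = l.castSucc ∧ q.1 = l.succ ∧ w l = j
        then (t : ℂ) * (1 : Mat n) p.2 q.2 else 0)

/-- The scale chosen in the definition of `deltaWord`. -/
def deltaScale (Q : Fin d → R →L[ℂ] S) {N : ℕ} {n : ℕ+} (w : Fin N → Fin d) (X : opBall Q n) : ℝ :=
  (exists_bidiag_mem Q w X).choose

theorem deltaScale_ne_zero {N : ℕ} {n : ℕ+} (w : Fin N → Fin d) (X : opBall Q n) :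
    (deltaScale Q w X : ℂ) ≠ 0 :=
  Complex.ofReal_ne_zero.2 (exists_bidiag_mem Q w X).choose_spec.1.ne'

theorem bidiagBlock_mem {N : ℕ} {n : ℕ+} (w : Fin N → Fin d) (X : opBall Q n) :
    relabel (blockEquiv N n) (bidiagBlock (deltaScale Q w X) w X.1) ∈ opBall Q _ :=
  (exists_bidiag_mem Q w X).choose_spec.2

theorem deltaWord_apply {N : ℕ} {n : ℕ+} (w : Fin N → Fin d) (f : GradedFun (opBall Q))
    (X : opBall Q n) (i k : Idx n) :
    deltaWord Q w f n X i k = ((deltaScale Q w X : ℂ) ^ N)⁻¹ *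
      f _ ⟨_, bidiagBlock_mem w X⟩ (blockEquiv N n (0, i)) (blockEquiv N n (Fin.last N, k)) := rfl

theorem deltaWord_zero {f : GradedFun (opBall Q)} (hf : IsNC f) (w : Fin 0 → Fin d) :
    deltaWord Q w f = f := by
  funext n X
  ext i k
  have h := hf.corner opBall_dsumClosed (blockEquiv 0 n) (Equiv.refl (Idx n))
    (bidiagBlock (deltaScale Q w X) w X.1) X.1 (bidiagBlock_mem w X) X.2
    (fun p => (0, p)) (fun p q h => (Prod.ext_iff.1 h).2) (fun _ => 1)
    (fun j c c' => by simp [bidiagBlock])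
    (fun j c s hs => absurd ⟨s.2, Prod.ext (Fin.fin_one_eq_zero s.1).symm rfl⟩ hs) i k
  rw [mul_one, one_mul] at h
  rw [deltaWord_apply, pow_zero, inv_one, one_mul]
  exact h.symm

/-- The tuple with diagonal blocks `0, …, 0, X` (the last one indexed by `none`), in which the
`j`-th of the first `d` blocks is linked to the last one by `t` in the `j`-th coordinate. -/
def fan {n : ℕ+} (t : ℝ) (X : Tup d n) (j : Fin d) :
    Matrix (Option (Fin d) × Idx n) (Option (Fin d) × Idx n) ℂ :=
  Matrix.of fun p q =>
    (if p.1 = none ∧ q.1 = none then X j p.2 q.2 else 0) +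
      (t : ℂ) * (if p.1 = some j ∧ q.1 = none ∧ p.2 = q.2 then 1 else 0)

theorem exists_fan_mem {n : ℕ+} (X : opBall Q n) :
    ∃ t : ℝ, 0 < t ∧ ‖evalQ Q (fan t X.1)‖ < 1 := by
  let V : Matrix (Option (Fin d) × Idx n) (Idx n) ℂ :=
    Matrix.of fun p q => if p = (none, q) then 1 else 0
  have hV : V.conjTranspose * V = 1 := by
    ext a b
    rw [Matrix.mul_apply, Finset.sum_eq_single (none, b)]
    · simp [V, Matrix.one_apply, eq_comm]
    · intro p _ hp
      simp [V, hp]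
    · simp
  have hA : ∀ j, V * X.1 j * V.conjTranspose = Matrix.of fun p q : Option (Fin d) × Idx n =>
      if p.1 = none ∧ q.1 = none then X.1 j p.2 q.2 else 0 := fun j => by
    ext ⟨a, p⟩ ⟨b, q⟩
    rw [Matrix.mul_apply]
    simp only [Matrix.mul_apply, V, Matrix.of_apply, Matrix.conjTranspose_apply, Prod.mk.injEq]
    rcases a with _ | a <;> rcases b with _ | b <;> simp
  have h := (norm_evalQ_extend_le Q hV hV X.1).trans_lt X.2
  obtain ⟨t, ht, h1⟩ := exists_pos_norm_evalQ_add_smul_lt Q _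
    (fun j => Matrix.of fun p q : Option (Fin d) × Idx n =>
      if p.1 = some j ∧ q.1 = none ∧ p.2 = q.2 then 1 else 0) h
  refine ⟨t, ht, ?_⟩
  simp only [hA] at h1
  exact h1

theorem bidiagBlock_one_apply {n : ℕ+} (t : ℝ) (j : Fin d) (X : Tup d n) (i : Fin d)
    (a b : Fin 2) (p q : Idx n) :
    bidiagBlock t (fun _ : Fin 1 => j) X i (a, p) (b, q) =
      (if a = 1 ∧ b = 1 then X i p q else 0) +
        if a = 0 ∧ b = 1 ∧ j = i then (t : ℂ) * (1 : Mat n) p q else 0 := by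
  have h : (∃ l : Fin 1, a = l.castSucc ∧ b = l.succ ∧ j = i) ↔ a = 0 ∧ b = 1 ∧ j = i :=
    Fin.exists_fin_one
  simp only [bidiagBlock, Matrix.of_apply, h]
  rfl

theorem fan_apply {n : ℕ+} (t : ℝ) (X : Tup d n) (i : Fin d) (a b : Option (Fin d))
    (p q : Idx n) : fan t X i (a, p) (b, q) =
      (if a = none ∧ b = none then X i p q else 0) +
        if a = some i ∧ b = none then (t : ℂ) * (1 : Mat n) p q else 0 := by
  simp only [fan, Matrix.of_apply, Matrix.one_apply, mul_ite, mul_one, mul_zero, ← ite_and,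
    and_assoc]

/-- The `j`-th link of `fan t X` is the value of the difference-differential in direction `j`. -/
theorem IsNC.fan_link {g : GradedFun (opBall Q)} (hg : IsNC g) {n m : ℕ+} (X : opBall Q n)
    (t : ℝ) (e : Option (Fin d) × Idx n ≃ Idx m) (hmem : relabel e (fan t X.1) ∈ opBall Q m)
    (j : Fin d) (p q : Idx n) : g m ⟨_, hmem⟩ (e (some j, p)) (e (none, q))
      = t * deltaWord Q (fun _ : Fin 1 => j) g n X p q := by
  set τ := deltaScale Q (fun _ : Fin 1 => j) X with hτ
  have hτ0 : (τ : ℂ) ≠ 0 := deltaScale_ne_zero _ _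
  have hτm := bidiagBlock_mem (fun _ : Fin 1 => j) X
  rw [← hτ] at hτm
  have h : g _ ⟨_, hτm⟩ (blockEquiv 1 n (0, p)) (blockEquiv 1 n (1, q)) * (t : ℂ)
      = (τ : ℂ) * g m ⟨_, hmem⟩ (e (some j, p)) (e (none, q)) := by
    refine hg.corner opBall_dsumClosed e (blockEquiv 1 n) (fan t X.1)
      (bidiagBlock τ (fun _ : Fin 1 => j) X.1) hmem hτm
      (fun p => (![some j, none] p.1, p.2)) ?_ (fun p => ![(τ : ℂ), t] p.1) ?_ ?_ (0, p) (1, q)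
    · rintro ⟨a, p⟩ ⟨b, q⟩ h
      obtain ⟨h1, h2⟩ := Prod.ext_iff.1 h
      refine Prod.ext ?_ h2
      revert a b
      simp [Fin.forall_fin_two]
    · rintro i ⟨a, p⟩ ⟨b, q⟩
      simp only [bidiagBlock_one_apply, fan_apply]
      revert a b
      by_cases hji : j = i
      · simp [Fin.forall_fin_two, hji, mul_comm]
        ring
      · simp [Fin.forall_fin_two, hji, mul_comm]
    · rintro i c ⟨_ | b, s⟩ hs
      · exact absurd ⟨(1, s), rfl⟩ hs
      · simp [fan_apply]
  rw [deltaWord_apply, pow_one, mul_left_comm, eq_inv_mul_iff_mul_eq₀ hτ0, mul_comm (t : ℂ)]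
  exact h.symm

/-- The first step of the Taylor expansion. The row `(X₁, …, X_d, -t)` intertwines the zero tuple
with `fan t X`. -/
theorem IsNC.eq_valueAtZero_add {g : GradedFun (opBall Q)} (hg : IsNC g) {n : ℕ+}
    (X : opBall Q n) :
    g n X = valueAtZero g • (1 : Mat n) +
      ∑ j, X.1 j * deltaWord Q (fun _ : Fin 1 => j) g n X := by
  obtain ⟨t, ht, hfan⟩ := exists_fan_mem X
  have ht0 : (t : ℂ) ≠ 0 := Complex.ofReal_ne_zero.2 ht.ne'
  obtain ⟨m, ⟨e⟩⟩ := exists_equiv_Idx (Option (Fin d) × Idx n)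
  have hmem := relabel_mem_opBall e hfan
  have hlast : ∀ p q, g m ⟨_, hmem⟩ (e (none, p)) (e (none, q)) = g n X p q := fun p q => by
    have h := hg.corner opBall_dsumClosed e (Equiv.refl (Idx n)) (fan t X.1) X.1 hmem X.2
      (fun p => (none, p)) (fun p q h => (Prod.ext_iff.1 h).2) (fun _ => 1)
      (fun j c c' => by simp [fan_apply])
      (fun j c s hs => by
        obtain ⟨_ | b, s⟩ := s
        · exact absurd ⟨s, rfl⟩ hs
        · simp [fan_apply]) p q
    rw [mul_one, one_mul] at h
    exact h.symm
  have hlink := fun j p q => hg.fan_link X t e hmem j p q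
  have key := hg.intertwine_relabel opBall_dsumClosed (Equiv.refl (Idx n)) e 0 (fan t X.1)
    (zero_mem_opBall n) hmem
    (Matrix.of fun p q => q.1.elim (if p = q.2 then -(t : ℂ) else 0) fun j => X.1 j p q.2)
    fun j => by
      rw [Pi.zero_apply, Matrix.zero_mul]
      ext p ⟨_ | b, q⟩
      · simp [Matrix.mul_apply, Fintype.sum_prod_type, Fintype.sum_option, fan_apply,
          Matrix.one_apply, mul_comm]
      · rw [Matrix.mul_apply]
        exact (Finset.sum_eq_zero fun c _ => by
          obtain ⟨c, r⟩ := c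
          simp [fan_apply]).symm
  ext p q
  have h := congrFun (congrFun key p) (none, q)
  have hz : g n ⟨relabel (Equiv.refl (Idx n)) 0, zero_mem_opBall n⟩ =
    valueAtZero g • (1 : Mat n) := hg.apply_zero n
  rw [hz] at h
  simp only [Matrix.mul_apply, Fintype.sum_prod_type, Fintype.sum_option, Matrix.of_apply,
    Matrix.submatrix_apply, Option.elim, hlast, hlink] at h
  have h2 : ∀ j, ∑ r, X.1 j p r * (t * deltaWord Q (fun _ : Fin 1 => j) g n X r q)
      = t * (X.1 j * deltaWord Q (fun _ : Fin 1 => j) g n X) p q := fun j => by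
    rw [Matrix.mul_apply, Finset.mul_sum]
    exact Finset.sum_congr rfl fun r _ => mul_left_comm _ _ _
  have h3 : ∑ r, (valueAtZero g • (1 : Mat n)) p r * (if r = q then -(t : ℂ) else 0)
      = -(t * (valueAtZero g • (1 : Mat n)) p q) := by simp [mul_comm]
  have h4 : ∑ r, (if p = r then -(t : ℂ) else 0) * g n X r q = -(t * g n X p q) := by simp
  simp only [Equiv.refl_apply, h2] at h
  rw [h3, h4, ← Finset.mul_sum] at h
  apply mul_left_cancel₀ ht0
  rw [Matrix.add_apply, Matrix.sum_apply]
  linear_combination h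

/-- Off the last diagonal block, `bidiagBlock` only consists of the links given by the word. -/
theorem bidiagBlock_link {N : ℕ} {n : ℕ+} (t : ℝ) (w : Fin N → Fin d) (X : Tup d n) (i : Fin d)
    (a b : Fin (N + 1)) (p q : Idx n) (hb : b ≠ Fin.last N ∨ a ≠ Fin.last N) :
    bidiagBlock t w X i (a, p) (b, q) =
      if ∃ l : Fin N, a = l.castSucc ∧ b = l.succ ∧ w l = i then (t : ℂ) * (1 : Mat n) p q
        else 0 := by
  simp only [bidiagBlock, Matrix.of_apply]
  rw [if_neg, zero_add]
  rintro ⟨h1, h2⟩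
  exact hb.elim (· h2) (· h1)

theorem bidiagBlock_last_last {N : ℕ} {n : ℕ+} (t : ℝ) (w : Fin N → Fin d) (X : Tup d n)
    (i : Fin d) (p q : Idx n) :
    bidiagBlock t w X i (Fin.last N, p) (Fin.last N, q) = X i p q := by
  simp only [bidiagBlock, Matrix.of_apply, and_self, if_true, add_eq_left]
  rw [if_neg]
  rintro ⟨l, h, -⟩
  exact l.castSucc_ne_last h.symm

/-- The links of the word `wj` between the blocks `0, …, N` are those of `w`. -/
theorem exists_link_snoc_iff {N : ℕ} (w : Fin N → Fin d) (i j : Fin d) (a b : Fin (N + 1)) :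
    (∃ l : Fin (N + 1), a.castSucc = l.castSucc ∧ b.castSucc = l.succ ∧
        (Fin.snoc w j : Fin (N + 1) → Fin d) l = i) ↔
      ∃ l : Fin N, a = l.castSucc ∧ b = l.succ ∧ w l = i := by
  constructor
  · rintro ⟨l, h1, h2, h3⟩
    obtain rfl := Fin.castSucc_injective _ h1
    induction a using Fin.lastCases with
    | last => exact absurd h2 (by rw [Fin.succ_last]; exact b.castSucc_ne_last)
    | cast a =>
      rw [Fin.snoc_castSucc] at h3
      rw [Fin.succ_castSucc] at h2
      exact ⟨a, rfl, Fin.castSucc_injective _ h2, h3⟩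
  · rintro ⟨l, rfl, rfl, h⟩
    exact ⟨l.castSucc, rfl, (Fin.succ_castSucc l).symm, by rwa [Fin.snoc_castSucc]⟩

/-- The only link of the word `wj` to its last block comes from block `N` and carries `j`. -/
theorem exists_link_snoc_last_iff {N : ℕ} (w : Fin N → Fin d) (i j : Fin d) (a : Fin (N + 1)) :
    (∃ l : Fin (N + 1), a.castSucc = l.castSucc ∧ Fin.last (N + 1) = l.succ ∧
        (Fin.snoc w j : Fin (N + 1) → Fin d) l = i) ↔ a = Fin.last N ∧ j = i := by
  constructor
  · rintro ⟨l, h1, h2, h3⟩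
    obtain rfl := Fin.castSucc_injective _ h1
    rw [← Fin.succ_last] at h2
    obtain rfl := Fin.succ_injective _ h2
    rw [Fin.snoc_last] at h3
    exact ⟨rfl, h3⟩
  · rintro ⟨rfl, h⟩
    exact ⟨Fin.last N, rfl, (Fin.succ_last N).symm, by rwa [Fin.snoc_last]⟩

/-- Difference-differentials compose: the bidiagonal point for the word `wj` is a corner of the
bidiagonal point for `w` over the bidiagonal point for `j`. -/
theorem deltaWord_snoc {f : GradedFun (opBall Q)} (hf : IsNC f) {N : ℕ} (w : Fin N → Fin d)
    (j : Fin d) :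
    deltaWord Q (fun _ : Fin 1 => j) (deltaWord Q w f) =
      deltaWord Q (Fin.snoc w j : Fin (N + 1) → Fin d) f := by
  funext n X
  ext p q
  set w' : Fin (N + 1) → Fin d := Fin.snoc w j with hw'
  set t := deltaScale Q (fun _ : Fin 1 => j) X with ht
  let P : opBall Q _ := ⟨_, bidiagBlock_mem (fun _ : Fin 1 => j) X⟩
  have hP : P.1 = relabel (blockEquiv 1 n) (bidiagBlock t (fun _ : Fin 1 => j) X.1) := rfl
  have hPe : ∀ (i : Fin d) (a b : Fin 2) (p q : Idx n), P.1 i (blockEquiv 1 n (a, p))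
      (blockEquiv 1 n (b, q)) = bidiagBlock t (fun _ : Fin 1 => j) X.1 i (a, p) (b, q) := by
    intro i a b p q
    simp [hP, relabel]
  set t' := deltaScale Q w P with ht'
  set τ := deltaScale Q w' X with hτ
  have ht0 : (t : ℂ) ≠ 0 := deltaScale_ne_zero _ _
  have ht0' : (t' : ℂ) ≠ 0 := deltaScale_ne_zero _ _
  have hτ0 : (τ : ℂ) ≠ 0 := deltaScale_ne_zero _ _
  have hA := bidiagBlock_mem w P
  have hB := bidiagBlock_mem w' X
  rw [← ht'] at hA
  rw [← hτ] at hB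
  -- `σ` follows the word: the first copy of `X`-blocks inside the blocks `0, …, N` of the point for
  -- `w`, and finally the second copy inside its last block
  let σ : Fin (N + 1 + 1) × Idx n → Fin (N + 1) × Idx (Nat.succPNat 1 * n) := fun c =>
    Fin.lastCases (motive := fun _ => Fin (N + 1) × Idx (Nat.succPNat 1 * n))
      (Fin.last N, blockEquiv 1 n (1, c.2)) (fun a => (a, blockEquiv 1 n (0, c.2))) c.1
  let α : Fin (N + 1 + 1) × Idx n → ℂ := fun c =>
    Fin.lastCases (motive := fun _ => ℂ) ((t' / τ : ℂ) ^ N * (t / τ))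
      (fun a => (t' / τ : ℂ) ^ (a : ℕ)) c.1
  have hσc : ∀ a p, σ (Fin.castSucc a, p) = (a, blockEquiv 1 n (0, p)) := fun a p => by
    simp [σ]
  have hσl : ∀ p, σ (Fin.last (N + 1), p) = (Fin.last N, blockEquiv 1 n (1, p)) := fun p => by
    simp [σ]
  have hαc : ∀ a p, α (Fin.castSucc a, p) = (t' / τ : ℂ) ^ (a : ℕ) := fun a p => by simp [α]
  have hαl : ∀ p, α (Fin.last (N + 1), p) = (t' / τ : ℂ) ^ N * (t / τ) := fun p => by simp [α]
  have h := hf.corner opBall_dsumClosed (blockEquiv N (Nat.succPNat 1 * n))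
    (blockEquiv (N + 1) n) (bidiagBlock t' w P.1) (bidiagBlock τ w' X.1) hA hB σ
    (by
      rintro ⟨a, p⟩ ⟨b, q⟩ h
      induction a using Fin.lastCases <;> induction b using Fin.lastCases <;>
        simp_all [Prod.ext_iff]) α
    (by
      rintro i ⟨a, p⟩ ⟨b, q⟩
      induction a using Fin.lastCases with
      | last =>
        induction b using Fin.lastCases with
        | last =>
          rw [bidiagBlock_last_last, hσl, hσl, hαl, bidiagBlock_last_last, hPe,
            bidiagBlock_one_apply]
          simp [mul_comm]
        | cast b =>
          rw [bidiagBlock_link _ _ _ _ _ _ _ _ (Or.inl b.castSucc_ne_last), hσl, hσc, if_neg,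
            zero_mul]
          · by_cases hb : b = Fin.last N
            · rw [hb, bidiagBlock_last_last, hPe, bidiagBlock_one_apply]
              simp
            · rw [bidiagBlock_link _ _ _ _ _ _ _ _ (Or.inl hb), if_neg, mul_zero]
              rintro ⟨l, h, -⟩
              exact l.castSucc_ne_last h.symm
          · rintro ⟨l, h, -⟩
            exact l.castSucc_ne_last h.symm
      | cast a =>
        induction b using Fin.lastCases with
        | last =>
          rw [bidiagBlock_link _ _ _ _ _ _ _ _ (Or.inr a.castSucc_ne_last), hσl, hσc, hαl, hαc]
          simp only [hw', exists_link_snoc_last_iff]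
          by_cases ha : a = Fin.last N
          · rw [ha, bidiagBlock_last_last, hPe, bidiagBlock_one_apply]
            by_cases hji : j = i
            · simp [hji]
              field_simp
            · simp [hji]
          · have hne : blockEquiv 1 n (0, p) ≠ blockEquiv 1 n (1, q) := by simp
            rw [bidiagBlock_link _ _ _ _ _ _ _ _ (Or.inr ha), Matrix.one_apply_ne hne]
            simp [ha]
        | cast b =>
          rw [bidiagBlock_link _ _ _ _ _ _ _ _ (Or.inl b.castSucc_ne_last), hσc, hσc, hαc, hαc]
          simp only [hw', exists_link_snoc_iff]
          by_cases hab : a = Fin.last N ∧ b = Fin.last N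
          · rw [hab.1, hab.2, bidiagBlock_last_last, hPe, bidiagBlock_one_apply, if_neg]
            · simp
            · rintro ⟨l, h, -⟩
              exact l.castSucc_ne_last h.symm
          · rw [bidiagBlock_link _ _ _ _ _ _ _ _ (by tauto)]
            split_ifs with hl
            · obtain ⟨l, rfl, rfl, -⟩ := hl
              simp only [Fin.val_succ, Fin.val_castSucc, pow_succ, Matrix.one_apply,
                (blockEquiv 1 n).injective.eq_iff, Prod.mk.injEq, true_and]
              field_simp
            · simp)
    (by
      rintro i ⟨a, p⟩ ⟨b, s⟩ hs
      obtain ⟨⟨x, s⟩, rfl⟩ := (blockEquiv 1 n).surjective s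
      obtain rfl | rfl : x = 0 ∨ x = 1 := by
        revert x
        simp [Fin.forall_fin_two]
      · exact absurd ⟨(b.castSucc, s), hσc _ _⟩ hs
      have hb : b ≠ Fin.last N := by
        rintro rfl
        exact hs ⟨(Fin.last _, s), hσl _⟩
      induction a using Fin.lastCases with
      | last =>
        rw [hσl, bidiagBlock_link _ _ _ _ _ _ _ _ (Or.inl hb), if_neg]
        rintro ⟨l, h, -⟩
        exact l.castSucc_ne_last h.symm
      | cast a =>
        rw [hσc, bidiagBlock_link _ _ _ _ _ _ _ _ (Or.inl hb), Matrix.one_apply_ne]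
        · simp
        · simp)
    (Fin.castSucc 0, p) (Fin.last (N + 1), q)
  rw [hσc, hσl, hαc, hαl, Fin.val_zero, pow_zero, one_mul] at h
  rw [deltaWord_apply, deltaWord_apply, deltaWord_apply]
  -- the weight at the last block compensates the three scales chosen by `deltaWord`
  refine Eq.trans (congrArg (fun z => ((t : ℂ) ^ 1)⁻¹ * (((t' : ℂ) ^ N)⁻¹ * z)) h.symm) ?_
  change _ = ((τ : ℂ) ^ (N + 1))⁻¹ * f _ ⟨_, hB⟩ (blockEquiv (N + 1) n (Fin.castSucc 0, p))
    (blockEquiv (N + 1) n (Fin.last (N + 1), q))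
  rw [div_pow, pow_succ (τ : ℂ) N]
  field_simp

theorem wordEval_snoc {n : ℕ+} {N : ℕ} (X : Tup d n) (w : Fin N → Fin d) (j : Fin d) :
    wordEval X (Fin.snoc w j : Fin (N + 1) → Fin d) = wordEval X w * X j := by
  rw [wordEval, List.ofFn_succ', List.prod_concat]
  simp [wordEval]

/-- The Taylor expansion of order `N` at the origin, with remainder. -/
theorem taylor_expansion {f : GradedFun (opBall Q)} (hf : IsNC f)
    (hΔ : ∀ (N : ℕ) (w : Fin N → Fin d), IsNC (deltaWord Q w f)) (N : ℕ) {n : ℕ+}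
    (X : opBall Q n) :
    f n X = ∑ k ∈ Finset.range N, ∑ w : Fin k → Fin d,
        valueAtZero (deltaWord Q w f) • wordEval X.1 w +
      ∑ w : Fin N → Fin d, wordEval X.1 w * deltaWord Q w f n X := by
  induction N with
  | zero => simp [wordEval, deltaWord_zero hf]
  | succ N ih =>
    rw [Finset.sum_range_succ, add_assoc]
    refine ih.trans (congrArg _ ?_)
    have h : ∀ w : Fin N → Fin d, wordEval X.1 w * deltaWord Q w f n X =
        valueAtZero (deltaWord Q w f) • wordEval X.1 w +
          ∑ j, wordEval X.1 (Fin.snoc w j : Fin (N + 1) → Fin d) *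
            deltaWord Q (Fin.snoc w j : Fin (N + 1) → Fin d) f n X := fun w => by
      conv_lhs => rw [(hΔ N w).eq_valueAtZero_add X]
      rw [mul_add, mul_smul_comm, mul_one, Finset.mul_sum]
      congr 1
      refine Finset.sum_congr rfl fun j _ => ?_
      rw [deltaWord_snoc hf, ← mul_assoc, wordEval_snoc]
    simp only [h, Finset.sum_add_distrib]
    congr 1
    rw [← (Fin.snocEquiv fun _ => Fin d).sum_comp, Fintype.sum_prod_type, Finset.sum_comm]
    rfl

/-! ### Homogeneous components -/

/-- The homogeneous component of degree `k` in the Taylor expansion at the origin. -/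
def homPart (f : GradedFun (opBall Q)) (k : ℕ) {n : ℕ+} (X : Tup d n) : Mat n :=
  ∑ w : Fin k → Fin d, valueAtZero (deltaWord Q w f) • wordEval X w

/-- The nilpotent shift of size `k + 1`. -/
def shift (k : ℕ) : Matrix (Fin (k + 1)) (Fin (k + 1)) ℂ :=
  Matrix.of fun a b => if (a : ℕ) + 1 = b then 1 else 0

theorem shift_pow_apply (k N : ℕ) (a b : Fin (k + 1)) :
    (shift k ^ N) a b = if (a : ℕ) + N = b then 1 else 0 := by
  induction N generalizing b with
  | zero => simp [Matrix.one_apply, Fin.ext_iff]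
  | succ N ih =>
    have hs : ∀ c, shift k c b = if (c : ℕ) + 1 = b then 1 else 0 := fun _ => rfl
    rw [pow_succ, Matrix.mul_apply]
    simp only [ih, hs]
    split_ifs with h
    · rw [Finset.sum_eq_single ⟨(a : ℕ) + N, by omega⟩]
      · rw [if_pos rfl, if_pos (by rw [← h, add_assoc]), one_mul]
      · intro c _ hc
        rw [if_neg (fun h' => hc (Fin.ext h'.symm)), zero_mul]
      · simp
    · refine Finset.sum_eq_zero fun c _ => ?_
      split_ifs <;> first | omega | simp

open scoped Kronecker in
/-- The shift is `J₁ J₂^*` for isometries `J₁`, `J₂`, so `X ⊗ shift` is in the ball with `X`. -/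
theorem shift_kronecker_mem {n : ℕ+} (k : ℕ) (X : opBall Q n) :
    relabel (blockEquiv k n) (fun j => shift k ⊗ₖ X.1 j) ∈ opBall Q (k.succPNat * n) := by
  let J₁ : Matrix (Fin (k + 1)) (Fin k) ℂ := Matrix.of fun a b => if a = b.castSucc then 1 else 0
  let J₂ : Matrix (Fin (k + 1)) (Fin k) ℂ := Matrix.of fun a b => if a = b.succ then 1 else 0
  have h1 : J₁.conjTranspose * J₁ = 1 := by
    ext a b
    simp [J₁, Matrix.mul_apply, Matrix.one_apply, eq_comm]
  have h2 : J₂.conjTranspose * J₂ = 1 := by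
    ext a b
    simp [J₂, Matrix.mul_apply, Matrix.one_apply, eq_comm]
  have h12 : J₁ * J₂.conjTranspose = shift k := by
    ext a b
    simp only [J₁, J₂, Matrix.mul_apply, Matrix.of_apply, Matrix.conjTranspose_apply, shift]
    split_ifs with h
    · have hk : (a : ℕ) < k := by omega
      rw [Finset.sum_eq_single ⟨a, hk⟩]
      · have ha : a = (⟨a, hk⟩ : Fin k).castSucc := rfl
        have hb : b = (⟨a, hk⟩ : Fin k).succ := Fin.ext h.symm
        rw [if_pos ha, if_pos hb]
        simp
      · intro c _ hc
        rw [if_neg, zero_mul]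
        rintro rfl
        exact hc rfl
      · simp
    · refine Finset.sum_eq_zero fun c _ => ?_
      split_ifs with h3 h4
      · refine absurd ?_ h
        rw [h3, h4]
        simp
      all_goals simp
  have hiso : ∀ J : Matrix (Fin (k + 1)) (Fin k) ℂ, J.conjTranspose * J = 1 →
      (J ⊗ₖ (1 : Mat n)).conjTranspose * (J ⊗ₖ (1 : Mat n)) = 1 := fun J hJ => by
    rw [Matrix.conjTranspose_kronecker, ← Matrix.mul_kronecker_mul, hJ,
      Matrix.conjTranspose_one, mul_one, Matrix.one_kronecker_one]
  refine relabel_mem_opBall _ ?_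
  have h := norm_evalQ_extend_le Q (hiso _ h1) (hiso _ h2)
    (fun j => (1 : Matrix (Fin k) (Fin k) ℂ) ⊗ₖ X.1 j)
  have h3 : ∀ j, J₁ ⊗ₖ (1 : Mat n) * (1 : Matrix (Fin k) (Fin k) ℂ) ⊗ₖ X.1 j *
      (J₂ ⊗ₖ (1 : Mat n)).conjTranspose = shift k ⊗ₖ X.1 j := fun j => by
    rw [Matrix.conjTranspose_kronecker, ← Matrix.mul_kronecker_mul, ← Matrix.mul_kronecker_mul,
      Matrix.conjTranspose_one, mul_one, Matrix.mul_one, one_mul, h12]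
  simp only [h3] at h
  exact h.trans_lt ((norm_evalQ_one_kronecker_le Q X.1).trans_lt X.2)

open scoped Kronecker in
theorem wordEval_shift_kronecker {n : ℕ+} (k : ℕ) (X : Tup d n) {N : ℕ} (w : Fin N → Fin d) :
    wordEval (relabel (blockEquiv k n) fun j => shift k ⊗ₖ X j) w =
      Matrix.reindex (blockEquiv k n) (blockEquiv k n) ((shift k ^ N) ⊗ₖ wordEval X w) := by
  induction N with
  | zero => simp [wordEval]
  | succ N ih =>
    obtain ⟨⟨j, w⟩, rfl⟩ := (Fin.snocEquiv fun _ => Fin d).surjective w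
    change wordEval _ (Fin.snoc w j : Fin (N + 1) → Fin d) =
      Matrix.reindex _ _ (_ ⊗ₖ wordEval X (Fin.snoc w j : Fin (N + 1) → Fin d))
    rw [wordEval_snoc, wordEval_snoc, ih, pow_succ, Matrix.mul_kronecker_mul, relabel,
      Matrix.reindex_apply, Matrix.reindex_apply, Matrix.submatrix_mul_equiv, Matrix.reindex_apply]

/-- The homogeneous component of degree `k` of `f` at `X` is the upper right block of the value of
`f` at `X ⊗ shift`, so its norm does not exceed that of `f`. -/
theorem norm_homPart_le {f : GradedFun (opBall Q)} (hf : IsNC f)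
    (hΔ : ∀ (N : ℕ) (w : Fin N → Fin d), IsNC (deltaWord Q w f)) {C : ℝ}
    (hC : ∀ (n : ℕ+) (X : opBall Q n), ‖f n X‖ ≤ C) (k : ℕ) {n : ℕ+} (X : opBall Q n) :
    ‖homPart f k X.1‖ ≤ C := by
  set e := blockEquiv k n with he
  have hT := shift_kronecker_mem k X
  have h : homPart f k X.1 = (f _ ⟨_, hT⟩).submatrix (fun p => e (0, p))
      fun q => e (Fin.last k, q) := by
    ext p q
    have hw : ∀ {N : ℕ} (w : Fin N → Fin d),
        wordEval (relabel (blockEquiv k n) fun j => Matrix.kroneckerMap (· * ·) (shift k) (X.1 j)) w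
          (e (0, p)) (e (Fin.last k, q)) = if N = k then wordEval X.1 w p q else 0 := by
      intro N w
      rw [wordEval_shift_kronecker]
      simp [he, shift_pow_apply]
    have hw0 : ∀ (w : Fin (k + 1) → Fin d),
        wordEval (relabel (blockEquiv k n)
          fun j => Matrix.kroneckerMap (· * ·) (shift k) (X.1 j)) w = 0 := by
      intro w
      rw [wordEval_shift_kronecker]
      have : shift k ^ (k + 1) = 0 := by
        ext a b
        rw [shift_pow_apply, if_neg (by omega)]
        rfl
      rw [this, Matrix.zero_kronecker]
      rfl
    rw [Matrix.submatrix_apply, taylor_expansion hf hΔ (k + 1)]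
    simp only [hw0, zero_mul, Finset.sum_const_zero, add_zero, Matrix.sum_apply,
      Matrix.smul_apply, hw, homPart]
    have h0 : ∑ l ∈ Finset.range k, ∑ w : Fin l → Fin d,
        valueAtZero (deltaWord Q w f) • (if l = k then wordEval X.1 w p q else 0) = 0 := by
      refine Finset.sum_eq_zero fun l hl => ?_
      have : l ≠ k := (Finset.mem_range.1 hl).ne
      simp [this]
    rw [Finset.sum_range_succ, h0, zero_add]
    simp
  rw [h]
  refine (norm_submatrix_le _ ?_ ?_).trans (hC _ _)
  · intro a b hab
    simpa using hab
  · intro a b hab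
    simpa using hab

/-- A word of length `k` in bidiagonal tuples moves by at most `k` blocks, so its upper right block
vanishes when `k < N`. -/
theorem wordEval_bidiagBlock_eq_zero {N : ℕ} {n : ℕ+} (t : ℝ) (w : Fin N → Fin d) (X : Tup d n)
    {k : ℕ} (v : Fin k → Fin d) (p q : Idx n) (l : Fin (N + 1)) (hl : k < l) :
    wordEval (relabel (blockEquiv N n) (bidiagBlock t w X)) v (blockEquiv N n (0, p))
      (blockEquiv N n (l, q)) = 0 := by
  induction k generalizing l q with
  | zero =>
    rw [wordEval, List.ofFn_zero, List.prod_nil, Matrix.one_apply_ne]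
    intro h
    have h0 : 0 = l := (Prod.ext_iff.1 ((blockEquiv N n).injective h)).1
    simp [← h0] at hl
  | succ k ih =>
    obtain ⟨⟨j, v⟩, rfl⟩ := (Fin.snocEquiv fun _ => Fin d).surjective v
    change wordEval _ (Fin.snoc v j : Fin (k + 1) → Fin d) _ _ = 0
    rw [wordEval_snoc, Matrix.mul_apply]
    refine Finset.sum_eq_zero fun c _ => ?_
    obtain ⟨⟨m, r⟩, rfl⟩ := (blockEquiv N n).surjective c
    by_cases hm : k < m
    · rw [ih _ _ _ hm, zero_mul]
    · have hml : (m : ℕ) + 1 < l := by omega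
      have : relabel (blockEquiv N n) (bidiagBlock t w X) j (blockEquiv N n (m, r))
          (blockEquiv N n (l, q)) = 0 := by
        simp only [relabel, Matrix.reindex_apply, Matrix.submatrix_apply,
          Equiv.symm_apply_apply]
        rw [bidiagBlock_link, if_neg]
        · rintro ⟨i, rfl, rfl, -⟩
          simp at hml
        · right
          rintro rfl
          have := l.is_lt
          simp only [Fin.val_last] at hml
          omega
      rw [this, mul_zero]

end Ball

/-! ### Completely contractive representations of a right regular ball -/

/-- A completely contractive representation does not increase the norm of a column: the column is
completed by zero columns to a square matrix. -/
theorem IsCC.enorm_colMat_le {d : ℕ} {Ω : GradedSet d} {n : ℕ+} {Φ : HInf Ω →ₐ[ℂ] Mat n}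
    (hΦ : IsCC Φ) {ι : Type} [Fintype ι] (G : ι → HInf Ω) :
    ‖colMat fun w => Φ (G w)‖ₑ ≤ supNorm (Ω := Ω) (fun m X => colMat fun w => (G w).1 m X) := by
  classical
  rcases isEmpty_or_nonempty ι with hι | hι
  · have : (colMat fun w => Φ (G w)) = 0 := by
      ext p
      exact hι.elim p.1
    rw [this, enorm_zero]
    exact zero_le
  let k := Fintype.card ι
  let e : ι ≃ Fin k := Fintype.equivFin ι
  let w₀ : ι := Classical.arbitrary ι
  let A : Matrix (Fin k) (Fin k) (HInf Ω) :=
    Matrix.of fun a b => if b = e w₀ then G (e.symm a) else 0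
  have h1 : ‖colMat fun w => Φ (G w)‖ₑ ≤ ‖Matrix.comp _ _ _ _ _ (A.map Φ)‖ₑ := by
    have h : (colMat fun w => Φ (G w)) = (Matrix.comp _ _ _ _ _ (A.map Φ)).submatrix
        (fun p : ι × Idx n => (e p.1, p.2)) fun q : Idx n => (e w₀, q) := by
      ext p q
      simp [colMat, A, Matrix.comp_apply]
    rw [h, enorm_le_iff_norm_le]
    refine norm_submatrix_le _ ?_ ?_
    · rintro ⟨a, p⟩ ⟨b, q⟩ hab
      simpa using hab
    · intro p q hpq
      simpa using hpq
  have h2 : ∀ (m : ℕ+) (X : Ω m), ‖Matrix.comp _ _ _ _ _ (A.map fun F => F.1 m X)‖ₑ ≤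
      ‖colMat fun w => (G w).1 m X‖ₑ := fun m X => by
    let V : Matrix (Fin k × Idx m) (Idx m) ℂ := Matrix.of fun p q => if p = (e w₀, q) then 1 else 0
    have hV : V.conjTranspose * V = 1 := by
      ext a b
      rw [Matrix.mul_apply, Finset.sum_eq_single (e w₀, b)]
      · simp [V, Matrix.one_apply, eq_comm]
      · intro p _ hp
        simp [V, hp]
      · simp
    have h : Matrix.comp _ _ _ _ _ (A.map fun F => F.1 m X) =
        (colMat fun w => (G w).1 m X).submatrix (fun p : Fin k × Idx m => (e.symm p.1, p.2)) id *
          V.conjTranspose := by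
      ext ⟨a, p⟩ ⟨b, q⟩
      by_cases hb : b = e w₀
      · simp [Matrix.mul_apply, colMat, A, Matrix.comp_apply, V, hb]
      · simp [Matrix.mul_apply, colMat, A, Matrix.comp_apply, V, hb]
    rw [h, enorm_le_iff_norm_le]
    calc _ ≤ ‖(colMat fun w => (G w).1 m X).submatrix
            (fun p : Fin k × Idx m => (e.symm p.1, p.2)) id‖ * ‖V.conjTranspose‖ :=
          Matrix.l2_opNorm_mul _ _
      _ ≤ ‖colMat fun w => (G w).1 m X‖ * 1 := by
          gcongr
          · refine norm_submatrix_le _ ?_ Function.injective_id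
            rintro ⟨a, p⟩ ⟨b, q⟩ hab
            simpa using hab
          · exact norm_conjTranspose_le_one hV
      _ = _ := mul_one _
  exact h1.trans ((hΦ k A).trans (iSup₂_mono h2))

theorem pointEval_isCC {d : ℕ} {Ω : GradedSet d} {n : ℕ+} (X : Ω n) : IsCC (pointEval X) :=
  fun _ A => le_iSup₂ (f := fun m X =>
    ‖Matrix.comp _ _ _ _ _ (A.map fun F : HInf Ω => F.1 m X)‖ₑ) n X

section Ball

variable {d : ℕ} {R : Type u} {S : Type v}
  [NormedAddCommGroup R] [InnerProductSpace ℂ R]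
  [NormedAddCommGroup S] [InnerProductSpace ℂ S] {Q : Fin d → R →L[ℂ] S}
  (hQ : LinearIndependent ℂ Q)

/-- The monomial `Z^w` as an element of `HInf (opBall Q)`. -/
def monomial {N : ℕ} (w : Fin N → Fin d) : HInf (opBall Q) :=
  (List.ofFn fun l => coord Q hQ (fun _ => subset_rfl) (w l)).prod

theorem map_monomial {N : ℕ} (w : Fin N → Fin d) {n : ℕ+} (Φ : HInf (opBall Q) →ₐ[ℂ] Mat n) :
    Φ (monomial hQ w) = wordEval (proj Q hQ (fun _ => subset_rfl) Φ) w := by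
  rw [monomial, map_list_prod, List.map_ofFn]
  rfl

theorem monomial_apply {N : ℕ} (w : Fin N → Fin d) {n : ℕ+} (X : opBall Q n) :
    (monomial hQ w).1 n X = wordEval X.1 w :=
  map_monomial hQ w (pointEval X)

/-- The Taylor polynomial of degree less than `N` at the origin. -/
def taylorPoly (f : GradedFun (opBall Q)) (N : ℕ) : HInf (opBall Q) :=
  ∑ k ∈ Finset.range N, ∑ w : Fin k → Fin d, valueAtZero (deltaWord Q w f) • monomial hQ w

theorem map_taylorPoly (f : GradedFun (opBall Q)) (N : ℕ) {n : ℕ+}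
    (Φ : HInf (opBall Q) →ₐ[ℂ] Mat n) :
    Φ (taylorPoly hQ f N) =
      ∑ k ∈ Finset.range N, homPart f k (proj Q hQ (fun _ => subset_rfl) Φ) := by
  simp only [taylorPoly, map_sum, map_smul, map_monomial, homPart]

theorem taylorPoly_apply (f : GradedFun (opBall Q)) (N : ℕ) {n : ℕ+} (X : opBall Q n) :
    (taylorPoly hQ f N).1 n X = ∑ k ∈ Finset.range N, homPart f k X.1 :=
  map_taylorPoly hQ f N (pointEval X)

/-- The Taylor polynomial does not contribute to the differences of order `N`. -/
theorem deltaWord_sub_taylorPoly (f : GradedFun (opBall Q)) {N : ℕ} (w : Fin N → Fin d) :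
    deltaWord Q w (f - (taylorPoly hQ f N).1) = deltaWord Q w f := by
  funext n X
  ext i k
  rw [deltaWord_apply, deltaWord_apply, Pi.sub_apply, Pi.sub_apply, Matrix.sub_apply,
    taylorPoly_apply, Matrix.sum_apply, Finset.sum_eq_zero, sub_zero]
  intro l hl
  rw [homPart, Matrix.sum_apply]
  refine Finset.sum_eq_zero fun v _ => ?_
  rw [Matrix.smul_apply, wordEval_bidiagBlock_eq_zero _ _ _ _ _ _ _
    (by simpa using hl), smul_zero]

theorem enorm_le_supNorm {d : ℕ} {Ω : GradedSet d} {ι κ : ℕ+ → Type}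
    [∀ n, Fintype (ι n)] [∀ n, Fintype (κ n)] [∀ n, DecidableEq (κ n)]
    (G : ∀ n : ℕ+, Ω n → Matrix (ι n) (κ n) ℂ) (n : ℕ+) (X : Ω n) : ‖G n X‖ₑ ≤ supNorm G :=
  le_iSup₂ (f := fun n X => ‖G n X‖ₑ) n X

theorem rowMat_mul_colMat {ι : Type} [Fintype ι] {n : ℕ+} (A B : ι → Mat n) :
    rowMat A * colMat B = ∑ w, A w * B w := by
  ext p q
  simp only [Matrix.mul_apply, rowMat, colMat, Matrix.of_apply, Fintype.sum_prod_type,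
    Matrix.sum_apply]

theorem enorm_matrix_mul_le {ι κ μ : Type} [Fintype ι] [Fintype κ] [Fintype μ] [DecidableEq κ]
    [DecidableEq μ] (A : Matrix ι κ ℂ) (B : Matrix κ μ ℂ) : ‖A * B‖ₑ ≤ ‖A‖ₑ * ‖B‖ₑ := by
  rw [enorm_eq_nnnorm, enorm_eq_nnnorm, enorm_eq_nnnorm, ← ENNReal.coe_mul]
  exact ENNReal.coe_le_coe.2 (Matrix.l2_opNNNorm_mul A B)

theorem wordEval_smul {n : ℕ+} (s : ℂ) (Y : Tup d n) {N : ℕ} (w : Fin N → Fin d) :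
    wordEval (fun j => s • Y j) w = s ^ N • wordEval Y w := by
  induction N with
  | zero => simp [wordEval]
  | succ N ih =>
    obtain ⟨⟨j, w⟩, rfl⟩ := (Fin.snocEquiv fun _ => Fin d).surjective w
    change wordEval _ (Fin.snoc w j : Fin (N + 1) → Fin d) =
      _ • wordEval Y (Fin.snoc w j : Fin (N + 1) → Fin d)
    rw [wordEval_snoc, wordEval_snoc, ih, smul_mul_smul_comm, pow_succ]

/-- Every point of the ball is a proper multiple of another one. -/
theorem exists_smul_mem {n : ℕ+} (X : opBall Q n) :
    ∃ (s : ℝ≥0) (Y : opBall Q n), s < 1 ∧ X.1 = fun j => ((s : ℝ) : ℂ) • Y.1 j := by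
  obtain ⟨s, h1, h2⟩ := exists_between (show ‖evalQ Q X.1‖ < 1 from X.2)
  have hs : 0 < s := (norm_nonneg (evalQ Q X.1)).trans_lt h1
  have hs0 : (s : ℂ) ≠ 0 := Complex.ofReal_ne_zero.2 hs.ne'
  refine ⟨⟨s, hs.le⟩, ⟨fun j => (s : ℂ)⁻¹ • X.1 j, ?_⟩, h2, ?_⟩
  · change ‖evalQ Q (fun j => (s : ℂ)⁻¹ • X.1 j)‖ < 1
    rw [evalQ_smul]
    refine (ContinuousLinearMap.opNorm_smul_le _ _).trans_lt ?_
    rw [norm_inv, Complex.norm_real, Real.norm_of_nonneg hs.le, inv_mul_lt_iff₀ hs, mul_one]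
    exact h1
  · funext j
    exact (smul_inv_smul₀ hs0 _).symm

/-- The value of the Taylor remainder under a completely contractive representation. The remainder
is `∑ Z^w g_w` with `g_w` its difference-differentials; the row `(X^w)` is `s ^ N` times a row
evaluated in the ball, and right regularity bounds its product with the column `(Φ(g_w))`. -/
theorem enorm_sub_taylorPoly_le {M : ℝ≥0}
    (hΔ : ∀ f ∈ HInf (opBall Q), ∀ (N : ℕ) (w : Fin N → Fin d), deltaWord Q w f ∈ HInf (opBall Q))
    (hM : ∀ (N : ℕ), ∀ f ∈ monomialIdeal Q N,
      supNorm (Ω := opBall Q) (fun _ X => rowMat fun w : Fin N → Fin d => wordEval X.1 w) *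
        supNorm (Ω := opBall Q)
          (fun n X => colMat fun w : Fin N → Fin d => deltaWord Q w f.1 n X) ≤ M * supNorm f.1)
    {n : ℕ+} {Φ : HInf (opBall Q) →ₐ[ℂ] Mat n} (hΦ : IsCC Φ) {s : ℝ≥0} (Y : opBall Q n)
    (hY : proj Q hQ (fun _ => subset_rfl) Φ = fun j => ((s : ℝ) : ℂ) • Y.1 j)
    (f : HInf (opBall Q)) (N : ℕ) :
    ‖Φ (f - taylorPoly hQ f.1 N)‖ₑ ≤ s ^ N * (M * supNorm (f - taylorPoly hQ f.1 N).1) := by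
  set r := f - taylorPoly hQ f.1 N with hr
  let G : (Fin N → Fin d) → HInf (opBall Q) := fun w => ⟨deltaWord Q w f.1, hΔ f.1 f.2 N w⟩
  have hsum : r = ∑ w, monomial hQ w * G w := by
    refine Subtype.ext (funext fun n => funext fun X => ?_)
    have h1 : (∑ w, monomial hQ w * G w).1 n X = ∑ w, (monomial hQ w).1 n X * (G w).1 n X := by
      change pointEval X _ = _
      rw [map_sum]
      simp only [map_mul]
      rfl
    have h2 : r.1 n X = f.1 n X - (taylorPoly hQ f.1 N).1 n X := rfl
    rw [h1, h2, taylorPoly_apply, sub_eq_iff_eq_add',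
      taylor_expansion f.2.1 (fun N w => (hΔ f.1 f.2 N w).1) N]
    simp only [monomial_apply]
    rfl
  -- the factorization already puts `r` in the algebraic ideal, so no weak-* closure is needed
  have hmem : r ∈ monomialIdeal Q N := fun I _ hI => by
    rw [hsum]
    exact sum_mem fun w _ => I.mul_mem_right _ _ (hI w _ fun n X => monomial_apply hQ w X)
  have hval : Φ r = rowMat (fun w : Fin N → Fin d => wordEval (fun j => ((s : ℝ) : ℂ) • Y.1 j) w) *
      colMat fun w => Φ (G w) := by
    rw [rowMat_mul_colMat, hsum, map_sum]
    simp only [map_mul, map_monomial, hY]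
  have hrow : ‖rowMat (fun w : Fin N → Fin d =>
      wordEval (fun j => ((s : ℝ) : ℂ) • Y.1 j) w)‖ₑ ≤ s ^ N *
        supNorm (Ω := opBall Q) (fun _ X => rowMat fun w : Fin N → Fin d => wordEval X.1 w) := by
    have h : rowMat (fun w : Fin N → Fin d => wordEval (fun j => ((s : ℝ) : ℂ) • Y.1 j) w)
        = ((s : ℝ) : ℂ) ^ N • rowMat (fun w : Fin N → Fin d => wordEval Y.1 w) := by
      ext p q
      simp only [rowMat, Matrix.of_apply, Matrix.smul_apply, wordEval_smul]
    have h2 : ‖((s : ℝ) : ℂ) ^ N‖ₑ = (s : ℝ≥0∞) ^ N := by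
      rw [enorm_pow, enorm_eq_nnnorm]
      simp
    rw [h, enorm_smul, h2]
    gcongr
    exact enorm_le_supNorm (Ω := opBall Q)
      (fun _ X => rowMat fun w : Fin N → Fin d => wordEval X.1 w) n Y
  have hcol := hΦ.enorm_colMat_le G
  have hreg := hM N r hmem
  have hdelta : ∀ w : Fin N → Fin d, deltaWord Q w r.1 = deltaWord Q w f.1 := fun w =>
    deltaWord_sub_taylorPoly hQ f.1 w
  simp only [hdelta] at hreg
  calc ‖Φ r‖ₑ ≤ _ := by rw [hval]; exact enorm_matrix_mul_le _ _
    _ ≤ (s ^ N *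
        supNorm (Ω := opBall Q) (fun _ X => rowMat fun w : Fin N → Fin d => wordEval X.1 w)) *
        supNorm (Ω := opBall Q)
          (fun n X => colMat fun w : Fin N → Fin d => deltaWord Q w f.1 n X) :=
      mul_le_mul' hrow hcol
    _ ≤ _ := by
      rw [mul_assoc]
      gcongr

theorem supNorm_sub_taylorPoly_le {f : HInf (opBall Q)}
    (hΔ : ∀ (N : ℕ) (w : Fin N → Fin d), IsNC (deltaWord Q w f.1)) {C : ℝ≥0}
    (hC : ∀ (n : ℕ+) (X : opBall Q n), ‖f.1 n X‖ ≤ C) (N : ℕ) :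
    supNorm (f - taylorPoly hQ f.1 N).1 ≤ ((N + 1) * C : ℝ≥0) := by
  refine iSup₂_le fun n X => ?_
  have h2 : (f - taylorPoly hQ f.1 N).1 n X = f.1 n X - (taylorPoly hQ f.1 N).1 n X := rfl
  rw [h2, taylorPoly_apply, enorm_eq_nnnorm, ENNReal.coe_le_coe, ← NNReal.coe_le_coe]
  refine (norm_sub_le _ _).trans ?_
  have h3 : ‖∑ k ∈ Finset.range N, homPart f.1 k X.1‖ ≤ N * C := by
    refine (norm_sum_le_of_le _ fun k _ => norm_homPart_le f.2.1 hΔ hC k X).trans ?_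
    simp
  have h4 := hC n X
  push_cast
  linarith

/-- On a right regular ball, a completely contractive representation is determined by its
projection to the ball. -/
theorem IsRightRegular.eq_of_proj_eq (hreg : IsRightRegular Q) {n : ℕ+} (X : opBall Q n)
    {Φ Ψ : HInf (opBall Q) →ₐ[ℂ] Mat n} (hΦ : IsCC Φ) (hΨ : IsCC Ψ)
    (hΦX : proj Q hQ (fun _ => subset_rfl) Φ = X.1)
    (hΨX : proj Q hQ (fun _ => subset_rfl) Ψ = X.1) : Φ = Ψ := by
  obtain ⟨hΔ, M, hM⟩ := hreg
  obtain ⟨s, Y, hs, hXY⟩ := exists_smul_mem X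
  refine AlgHom.ext fun f => ?_
  obtain ⟨C₀, hC₀⟩ := f.2.2
  let C : ℝ≥0 := C₀.toNNReal
  have hC : ∀ (n : ℕ+) (X : opBall Q n), ‖f.1 n X‖ ≤ C := fun n X =>
    (hC₀ n X).trans (Real.le_coe_toNNReal _)
  have hbound : ∀ (Θ : HInf (opBall Q) →ₐ[ℂ] Mat n), IsCC Θ →
      proj Q hQ (fun _ => subset_rfl) Θ = X.1 → ∀ N : ℕ,
      ‖Θ f - Θ (taylorPoly hQ f.1 N)‖ ≤ s ^ N * (M * ((N + 1) * C)) := by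
    intro Θ hΘ hΘX N
    have h := enorm_sub_taylorPoly_le hQ hΔ hM hΘ Y (hΘX.trans hXY) f N
    have h2 := h.trans (mul_le_mul_right (mul_le_mul_right (supNorm_sub_taylorPoly_le hQ
      (fun N w => (hΔ f.1 f.2 N w).1) hC N) _) _)
    rw [map_sub, enorm_eq_nnnorm, ← ENNReal.coe_pow, ← ENNReal.coe_mul, ← ENNReal.coe_mul,
      ENNReal.coe_le_coe, ← NNReal.coe_le_coe] at h2
    simpa using h2
  have hlim : Filter.Tendsto (fun N : ℕ => 2 * ((s : ℝ) ^ N * (M * ((N + 1) * C))))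
      Filter.atTop (nhds 0) := by
    have h1 := tendsto_self_mul_const_pow_of_lt_one s.coe_nonneg (show (s : ℝ) < 1 from hs)
    have h2 := tendsto_pow_atTop_nhds_zero_of_lt_one s.coe_nonneg (show (s : ℝ) < 1 from hs)
    have h3 := (h1.add h2).const_mul (2 * M * C : ℝ)
    rw [add_zero, mul_zero] at h3
    refine h3.congr fun N => ?_
    ring
  have hle : ‖Φ f - Ψ f‖ ≤ 0 := ge_of_tendsto' hlim fun N => by
    have h1 := hbound Φ hΦ hΦX N
    have h2 := hbound Ψ hΨ hΨX N
    have h3 : Φ (taylorPoly hQ f.1 N) = Ψ (taylorPoly hQ f.1 N) := by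
      rw [map_taylorPoly, map_taylorPoly, hΦX, hΨX]
    have h4 : Φ f - Ψ f = (Φ f - Φ (taylorPoly hQ f.1 N)) - (Ψ f - Ψ (taylorPoly hQ f.1 N)) := by
      rw [h3]
      abel
    rw [h4]
    refine (norm_sub_le _ _).trans ?_
    linarith
  exact sub_eq_zero.1 (norm_le_zero_iff.1 hle)

end Ball

/-! ### Semi-invariant subspaces and functionals on matrix algebras -/

open Matrix in
/-- The columns of `V` form an orthonormal basis of a given subspace of `ℂ^κ`. -/
theorem exists_isometry_onto {κ : Type} [Fintype κ] (M : Submodule ℂ (κ → ℂ)) :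
    ∃ (k : ℕ) (V : Matrix κ (Fin k) ℂ), Vᴴ * V = 1 ∧ (∀ x ∈ M, V *ᵥ (Vᴴ *ᵥ x) = x) ∧
      ∀ c, V *ᵥ c ∈ M := by
  let M' : Submodule ℂ (EuclideanSpace ℂ κ) :=
    M.comap (WithLp.linearEquiv 2 ℂ (κ → ℂ)).toLinearMap
  let b := stdOrthonormalBasis ℂ M'
  let V : Matrix κ (Fin (Module.finrank ℂ M')) ℂ := Matrix.of fun i r => (b r : EuclideanSpace ℂ κ) i
  have hV : ∀ c, V *ᵥ c = WithLp.ofLp ((∑ r, c r • b r : M') : EuclideanSpace ℂ κ) := fun c => by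
    ext i
    simp [V, Matrix.mulVec, dotProduct, mul_comm]
  have hVt : ∀ x : M', ∀ r, (Vᴴ *ᵥ WithLp.ofLp (x : EuclideanSpace ℂ κ)) r = inner ℂ (b r) x :=
    fun x r => by
    rw [Submodule.coe_inner, PiLp.inner_apply]
    simp [V, Matrix.mulVec, dotProduct, mul_comm]
  refine ⟨_, V, ?_, fun x hx => ?_, fun c => ?_⟩
  · ext r s
    have h := hVt (b s) r
    rw [orthonormal_iff_ite.1 b.orthonormal r s] at h
    rw [Matrix.one_apply]
    exact h
  · let x' : M' := ⟨WithLp.toLp 2 x, hx⟩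
    rw [hV]
    have h : (Vᴴ *ᵥ x) = fun r => inner ℂ (b r) x' := funext fun r => hVt x' r
    rw [h, b.sum_repr' x']
  · rw [hV]
    exact (∑ r, c r • b r : M').2

open Matrix in
/-- Two nested subspaces `N ≤ M` of `ℂ^κ`, a projection `P` onto `N`, and an isometry `V` onto the
orthogonal complement of `N` in `M`. -/
theorem exists_isometry_onto_complement {κ : Type} [Fintype κ]
    {M N : Submodule ℂ (κ → ℂ)} (hNM : N ≤ M) :
    ∃ (k : ℕ) (V : Matrix κ (Fin k) ℂ) (P : Matrix κ κ ℂ), Vᴴ * V = 1 ∧ (∀ x, P *ᵥ x ∈ N) ∧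
      (∀ x ∈ N, Vᴴ *ᵥ x = 0) ∧ (∀ x ∈ M, x = P *ᵥ x + V *ᵥ (Vᴴ *ᵥ x)) ∧ ∀ c, V *ᵥ c ∈ M := by
  obtain ⟨l, U, -, hU, hUN⟩ := exists_isometry_onto N
  let K : Submodule ℂ (κ → ℂ) :=
    { carrier := {x | x ∈ M ∧ ∀ y ∈ N, star y ⬝ᵥ x = 0}
      add_mem' := fun hx hy => ⟨M.add_mem hx.1 hy.1, fun z hz => by
        rw [dotProduct_add, hx.2 z hz, hy.2 z hz, add_zero]⟩
      zero_mem' := ⟨M.zero_mem, fun z _ => dotProduct_zero _⟩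
      smul_mem' := fun c x hx => ⟨M.smul_mem c hx.1, fun z hz => by
        rw [dotProduct_smul, hx.2 z hz, smul_zero]⟩ }
  obtain ⟨k, V, hV, hVK, hK⟩ := exists_isometry_onto K
  have hVN : ∀ x ∈ N, Vᴴ *ᵥ x = 0 := fun x hx => by
    classical
    ext r
    have h := (hK (Pi.single r 1)).2 x hx
    rw [mulVec_single_one] at h
    have h2 : star (star x ⬝ᵥ V.col r) = 0 := by rw [h, star_zero]
    rw [star_dotProduct, star_star, dotProduct_comm] at h2
    rw [dotProduct_comm] at h2
    exact h2
  refine ⟨k, V, U * Uᴴ, hV, fun x => ?_, hVN, fun x hx => ?_, fun c => (hK c).1⟩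
  · rw [← mulVec_mulVec]
    exact hUN _
  · have hP : (U * Uᴴ) *ᵥ x ∈ N := by
      rw [← mulVec_mulVec]
      exact hUN _
    have h1 : x - (U * Uᴴ) *ᵥ x ∈ K := by
      refine ⟨M.sub_mem hx (hNM hP), fun y hy => ?_⟩
      have h2 : star y ⬝ᵥ ((U * Uᴴ) *ᵥ x) = star ((U * Uᴴ) *ᵥ y) ⬝ᵥ x := by
        rw [dotProduct_mulVec, star_mulVec, conjTranspose_mul, conjTranspose_conjTranspose]
      rw [dotProduct_sub, h2, ← mulVec_mulVec, hU y hy, sub_self]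
    have h3 := hVK _ h1
    rw [mulVec_sub, hVN _ hP, sub_zero] at h3
    rw [h3]
    abel

open Matrix in
/-- Compression to a semi-invariant subspace is multiplicative. -/
theorem polyEval_compression {d k : ℕ} {κ : Type} [Fintype κ] [DecidableEq κ]
    {M N : Submodule ℂ (κ → ℂ)} {A : Fin d → Matrix κ κ ℂ}
    (hM : ∀ p, ∀ x ∈ M, polyEval A p *ᵥ x ∈ M) (hN : ∀ p, ∀ x ∈ N, polyEval A p *ᵥ x ∈ N)
    {V : Matrix κ (Fin k) ℂ} {P : Matrix κ κ ℂ} (hV : Vᴴ * V = 1) (hP : ∀ x, P *ᵥ x ∈ N)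
    (hVN : ∀ x ∈ N, Vᴴ *ᵥ x = 0) (hdec : ∀ x ∈ M, x = P *ᵥ x + V *ᵥ (Vᴴ *ᵥ x))
    (hVM : ∀ c, V *ᵥ c ∈ M) (p : FreeAlgebra ℂ (Fin d)) :
    polyEval (fun j => Vᴴ * A j * V) p = Vᴴ * polyEval A p * V := by
  induction p using FreeAlgebra.induction with
  | grade0 r => simp [Algebra.algebraMap_eq_smul_one, hV]
  | grade1 j => simp
  | add a b ha hb => rw [map_add, map_add, ha, hb, Matrix.mul_add, Matrix.add_mul]
  | mul a b ha hb =>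
    rw [map_mul, map_mul, ha, hb]
    refine Matrix.mulVec_injective (funext fun c => ?_)
    simp only [← mulVec_mulVec]
    set y := polyEval A b *ᵥ (V *ᵥ c) with hy
    have hyM : y ∈ M := hM b _ (hVM c)
    conv_rhs => rw [hdec y hyM, mulVec_add, mulVec_add, hVN _ (hN a _ (hP y)), zero_add]

open Matrix in
theorem norm_mul_diagonal_inv_mul_le_one {ι : Type} [Fintype ι] [DecidableEq ι]
    {U T : Matrix ι ι ℂ} {σ : ι → ℝ} (hU : Uᴴ * U = 1)
    (hT : Tᴴ * T = Matrix.diagonal fun a => ((σ a : ℂ) * σ a)) :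
    ‖U * Matrix.diagonal (fun a => ((σ a)⁻¹ : ℂ)) * Tᴴ‖ ≤ 1 := by
  set D : Matrix ι ι ℂ := Matrix.diagonal fun a => ((σ a)⁻¹ : ℂ) with hDdef
  have hD : Dᴴ = D := by
    rw [Matrix.diagonal_conjTranspose]
    congr 1
    funext a
    simp
  have h1 : (U * D * Tᴴ) * (U * D * Tᴴ)ᴴ = U * (D * (Tᴴ * T) * D) * Uᴴ := by
    simp only [conjTranspose_mul, conjTranspose_conjTranspose, hD, Matrix.mul_assoc]
  have h2 : ‖D * (Tᴴ * T) * D‖ ≤ 1 := by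
    rw [hT, Matrix.diagonal_mul_diagonal, Matrix.diagonal_mul_diagonal,
      Matrix.l2_opNorm_diagonal]
    refine (pi_norm_le_iff_of_nonneg zero_le_one).2 fun a => ?_
    by_cases ha : (σ a : ℂ) = 0
    · simp [ha]
    · rw [inv_mul_cancel_left₀ ha, mul_inv_cancel₀ ha, norm_one]
  have h3 : ‖U * (D * (Tᴴ * T) * D) * Uᴴ‖ ≤ 1 := by
    generalize D * (Tᴴ * T) * D = W at h2
    have h4 := norm_le_one_of_conjTranspose_mul_self hU
    have h5 := norm_conjTranspose_le_one hU
    have h6 : ‖U * W‖ ≤ 1 :=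
      (Matrix.l2_opNorm_mul U W).trans (mul_le_one₀ h4 (norm_nonneg W) h2)
    exact (Matrix.l2_opNorm_mul (U * W) Uᴴ).trans (mul_le_one₀ h6 (norm_nonneg Uᴴ) h5)
  rw [← h1] at h3
  generalize U * D * Tᴴ = Z at h3
  have h7 := Matrix.l2_opNorm_conjTranspose_mul_self Zᴴ
  rw [conjTranspose_conjTranspose, Matrix.l2_opNorm_conjTranspose] at h7
  nlinarith [norm_nonneg Z]

open Matrix ComplexOrder in
/-- A singular value decomposition `∑ σ_a u_a v_a^*` of the matrix representing a functional of
norm at most one on a matrix algebra. The sum of the singular values is the value of the functional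
at a contraction, hence at most one. Column `a` of `U` is a unit vector, column `a` of `T` is a
vector of length `σ a`. -/
theorem exists_singular_vectors {ι : Type} [Fintype ι] [DecidableEq ι]
    (φ : Matrix ι ι ℂ →ₗ[ℂ] ℂ) (hφ : ∀ x, ‖φ x‖ ≤ ‖x‖) :
    ∃ (U T : Matrix ι ι ℂ) (σ : ι → ℝ), (∀ a, 0 ≤ σ a) ∧ (∑ a, σ a ≤ 1) ∧
      (∀ a, ∑ j, ‖U j a‖ ^ 2 = 1) ∧ (∀ a, ∑ j, ‖T j a‖ ^ 2 = σ a * σ a) ∧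
      ∀ x, φ x = ∑ a, ∑ i, star (U i a) * ∑ j, x i j * T j a := by
  let τ : Matrix ι ι ℂ := Matrix.of fun j i => φ (Matrix.single i j 1)
  have hτ : ∀ x, φ x = (x * τ).trace := fun x => by
    conv_lhs => rw [Matrix.matrix_eq_sum_single x]
    simp only [map_sum, Matrix.trace, Matrix.diag, Matrix.mul_apply, τ, Matrix.of_apply]
    refine Finset.sum_congr rfl fun i _ => Finset.sum_congr rfl fun j _ => ?_
    rw [← mul_one (x i j), ← smul_eq_mul, ← Matrix.smul_single, map_smul]
    simp
  have hpsd : (τᴴ * τ).PosSemidef := Matrix.posSemidef_conjTranspose_mul_self τ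
  let U : Matrix ι ι ℂ := hpsd.1.eigenvectorUnitary
  have hU : Uᴴ * U = 1 := Unitary.coe_star_mul_self hpsd.1.eigenvectorUnitary
  have hU' : U * Uᴴ = 1 := Unitary.coe_mul_star_self hpsd.1.eigenvectorUnitary
  let σ : ι → ℝ := fun a => Real.sqrt (hpsd.1.eigenvalues a)
  have hσ0 : ∀ a, 0 ≤ σ a := fun a => Real.sqrt_nonneg _
  have hσ : ∀ a, σ a * σ a = hpsd.1.eigenvalues a := fun a =>
    Real.mul_self_sqrt (hpsd.eigenvalues_nonneg a)
  let T : Matrix ι ι ℂ := τ * U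
  have hT : Tᴴ * T = Matrix.diagonal fun a => ((σ a : ℂ) * σ a) := by
    have h := hpsd.1.conjStarAlgAut_star_eigenvectorUnitary
    rw [Unitary.conjStarAlgAut_star_apply] at h
    have h1 : Tᴴ * T = Uᴴ * (τᴴ * τ) * U := by
      simp only [T, conjTranspose_mul, Matrix.mul_assoc]
    rw [h1]
    refine h.trans (congrArg _ (funext fun a => ?_))
    rw [← Complex.ofReal_mul, hσ]
    rfl
  have hTcol : ∀ a, ∑ j, ‖T j a‖ ^ 2 = σ a * σ a := fun a => by
    have h := congrFun (congrFun hT a) a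
    rw [Matrix.mul_apply, Matrix.diagonal_apply_eq] at h
    apply Complex.ofReal_injective
    push_cast
    rw [← h]
    refine Finset.sum_congr rfl fun j _ => ?_
    rw [conjTranspose_apply, ← Complex.conj_mul']
    rfl
  have hUcol : ∀ a, ∑ j, ‖U j a‖ ^ 2 = 1 := fun a => by
    have h := congrFun (congrFun hU a) a
    rw [Matrix.mul_apply, Matrix.one_apply_eq] at h
    apply Complex.ofReal_injective
    push_cast
    rw [← h]
    refine Finset.sum_congr rfl fun j _ => ?_
    rw [conjTranspose_apply, ← Complex.conj_mul']
    rfl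
  have hsum : ∑ a, σ a ≤ 1 := by
    let D : Matrix ι ι ℂ := Matrix.diagonal fun a => ((σ a)⁻¹ : ℂ)
    have hx : ‖U * D * Tᴴ‖ ≤ 1 := norm_mul_diagonal_inv_mul_le_one hU hT
    have hval : φ (U * D * Tᴴ) = ((∑ a, σ a : ℝ) : ℂ) := by
      have h1 : (U * D * Tᴴ * τ).trace = (D * (Tᴴ * T)).trace := by
        rw [Matrix.mul_assoc, Matrix.mul_assoc, Matrix.trace_mul_comm, ← Matrix.mul_assoc]
        simp only [T, Matrix.mul_assoc]
      rw [hτ, h1, hT, Matrix.diagonal_mul_diagonal, Matrix.trace_diagonal, Complex.ofReal_sum]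
      refine Finset.sum_congr rfl fun a _ => ?_
      by_cases ha : (σ a : ℂ) = 0
      · simp [ha]
      · rw [inv_mul_cancel_left₀ ha]
    have h := (hφ _).trans hx
    rw [hval, Complex.norm_real] at h
    exact (le_abs_self _).trans h
  refine ⟨U, T, σ, hσ0, hsum, hUcol, hTcol, fun x => ?_⟩
  have hTU : τ = T * Uᴴ := by rw [Matrix.mul_assoc, hU', Matrix.mul_one]
  rw [hτ, hTU, ← Matrix.mul_assoc, Matrix.trace_mul_comm]
  simp only [Matrix.trace, Matrix.diag, Matrix.mul_apply, conjTranspose_apply]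

open Matrix in
/-- A functional of norm at most one on a matrix algebra is a vector functional of an
amplification, given by the singular vectors scaled by square roots of the singular values. -/
theorem exists_vectors_of_norm_le {ι : Type} [Fintype ι] [DecidableEq ι]
    (φ : Matrix ι ι ℂ →ₗ[ℂ] ℂ) (hφ : ∀ x, ‖φ x‖ ≤ ‖x‖) :
    ∃ ξ η : ι × ι → ℂ, (∑ c, ‖ξ c‖ ^ 2 ≤ 1) ∧ (∑ c, ‖η c‖ ^ 2 ≤ 1) ∧
      ∀ x, φ x = star η ⬝ᵥ (Matrix.kroneckerMap (· * ·) (1 : Matrix ι ι ℂ) x *ᵥ ξ) := by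
  obtain ⟨U, T, σ, hσ0, hsum, hUcol, hTcol, hval⟩ := exists_singular_vectors φ hφ
  let ρ : ι → ℝ := fun a => Real.sqrt (σ a)
  have hρ : ∀ a, ρ a * ρ a = σ a := fun a => Real.mul_self_sqrt (hσ0 a)
  refine ⟨fun c => T c.2 c.1 * ((ρ c.1)⁻¹ : ℂ), fun c => U c.2 c.1 * (ρ c.1 : ℂ), ?_, ?_,
    fun x => ?_⟩
  · rw [Fintype.sum_prod_type]
    refine le_trans (le_of_eq (Finset.sum_congr rfl fun a _ => ?_)) hsum
    simp only [norm_mul, mul_pow, ← Finset.sum_mul, hTcol, norm_inv, Complex.norm_real,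
      Real.norm_eq_abs, inv_pow, sq_abs]
    rw [sq, hρ]
    by_cases ha : σ a = 0
    · simp [ha]
    · field_simp
  · rw [Fintype.sum_prod_type]
    refine le_trans (le_of_eq (Finset.sum_congr rfl fun a _ => ?_)) hsum
    simp only [norm_mul, mul_pow, ← Finset.sum_mul, hUcol, Complex.norm_real,
      Real.norm_eq_abs, sq_abs]
    rw [sq, hρ, one_mul]
  · have hcancel : ∀ i a j, star (U i a * (ρ a : ℂ)) * (x i j * (T j a * ((ρ a)⁻¹ : ℂ)))
        = x i j * (T j a * star (U i a)) := fun i a j => by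
      by_cases ha : ρ a = 0
      · have hs : σ a = 0 := by rw [← hρ, ha, mul_zero]
        have hTz : T j a = 0 := by
          have h := hTcol a
          rw [hs, mul_zero] at h
          have h2 := (Finset.sum_eq_zero_iff_of_nonneg fun j _ => by positivity).1 h j
            (Finset.mem_univ j)
          simpa using h2
        simp [hTz]
      · have ha' : (ρ a : ℂ) ≠ 0 := Complex.ofReal_ne_zero.2 ha
        rw [star_mul', show star (ρ a : ℂ) = ρ a from Complex.conj_ofReal _]
        field_simp
    have hmul : ∀ (a i : ι), (Matrix.kroneckerMap (· * ·) (1 : Matrix ι ι ℂ) x *ᵥ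
        fun c : ι × ι => T c.2 c.1 * ((ρ c.1)⁻¹ : ℂ)) (a, i) =
          ∑ j, x i j * (T j a * ((ρ a)⁻¹ : ℂ)) := fun a i => by
      rw [Matrix.mulVec, dotProduct, Fintype.sum_prod_type, Finset.sum_eq_single a]
      · simp
      · intro b _ hb
        simp [Matrix.one_apply_ne hb.symm]
      · simp
    rw [hval, dotProduct, Fintype.sum_prod_type]
    refine Finset.sum_congr rfl fun a _ => Finset.sum_congr rfl fun i _ => ?_
    rw [hmul, Finset.mul_sum, Finset.mul_sum]
    refine Finset.sum_congr rfl fun j _ => ?_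
    rw [Pi.star_apply, hcancel]
    ring

/-! ### Values of nc functions as polynomials -/

theorem isNC_polyEval {d : ℕ} {Ω : GradedSet d} (p : FreeAlgebra ℂ (Fin d)) :
    IsNC (Ω := Ω) fun _ X => polyEval X.1 p :=
  IsNC.of_intertwine fun _ _ _ _ _ h => polyEval_intertwine h p

theorem polyEval_dsumTup {d : ℕ} {m n : ℕ+} (X : Tup d m) (Y : Tup d n)
    (p : FreeAlgebra ℂ (Fin d)) :
    polyEval (dsumTup X Y) p = dsum (polyEval X p) (polyEval Y p) :=
  (isNC_polyEval (Ω := fun _ => Set.univ) p).map_dsum m n ⟨X, trivial⟩ ⟨Y, trivial⟩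
    trivial

theorem dsum_inj {m n : ℕ+} {A A' : Mat m} {B B' : Mat n} (h : dsum A B = dsum A' B') :
    A = A' ∧ B = B' := by
  have h1 := Matrix.fromBlocks_inj.1 ((Matrix.reindex _ _).injective h)
  exact ⟨h1.1, h1.2.2.2⟩

section Ball

variable {d : ℕ} {R : Type u} {S : Type v}
  [NormedAddCommGroup R] [InnerProductSpace ℂ R]
  [NormedAddCommGroup S] [InnerProductSpace ℂ S] {Q : Fin d → R →L[ℂ] S}

open scoped Kronecker in
/-- A subset of the ball that is closed under direct sums, amplifications, and restrictions to
invariant subspaces that lie in the ball. -/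
structure IsHereditary (Q : Fin d → R →L[ℂ] S) (Ω : GradedSet d) : Prop where
  subset : ∀ n, Ω n ⊆ opBall Q n
  dsum : DsumClosed Ω
  amplify : ∀ {m n : ℕ+} {α : Type} [Fintype α] [DecidableEq α] (e : α × Idx m ≃ Idx n)
    (A : Tup d m), A ∈ Ω m → relabel e (fun j => (1 : Matrix α α ℂ) ⊗ₖ A j) ∈ Ω n
  restrict : ∀ {m n : ℕ+} {A : Tup d m} {B : Tup d n}, A ∈ Ω m → B ∈ opBall Q n →
    ∀ (L : Matrix (Idx m) (Idx n) ℂ) (L' : Matrix (Idx n) (Idx m) ℂ), L' * L = 1 →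
      (∀ j, A j * L = L * B j) → B ∈ Ω n

theorem isHereditary_opBall : IsHereditary Q (opBall Q) where
  subset _ := subset_rfl
  dsum := opBall_dsumClosed
  amplify e A hA := relabel_mem_opBall e ((norm_evalQ_one_kronecker_le Q A).trans_lt hA)
  restrict _ hB _ _ _ _ := hB

/-- The inclusion of the copy of `ℂ^ι` with index `a` into `ℂ^(α × ι)`. -/
def copyIncl {α : Type} (ι : Type) [DecidableEq α] [DecidableEq ι] (a : α) :
    Matrix (α × ι) ι ℂ :=
  Matrix.of fun c k => if c = (a, k) then 1 else 0

theorem mul_copyIncl_apply {α ι κ : Type} [Fintype α] [Fintype ι] [DecidableEq α] [DecidableEq ι]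
    (G : Matrix κ (α × ι) ℂ) (a : α) (c : κ) (k : ι) : (G * copyIncl ι a) c k = G c (a, k) := by
  simp [Matrix.mul_apply, copyIncl]

theorem copyIncl_mul_apply {α ι : Type} [Fintype ι] [DecidableEq α] [DecidableEq ι]
    (G : Matrix ι ι ℂ) (a b : α) (i k : ι) :
    (copyIncl ι a * G) (b, i) k = if b = a then G i k else 0 := by
  by_cases h : b = a <;> simp [Matrix.mul_apply, copyIncl, h]

open scoped Kronecker in
theorem one_kronecker_mul_copyIncl {α ι : Type} [Fintype α] [Fintype ι] [DecidableEq α]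
    [DecidableEq ι] (G : Matrix ι ι ℂ) (a : α) :
    (1 : Matrix α α ℂ) ⊗ₖ G * copyIncl ι a = copyIncl ι a * G := by
  ext ⟨b, i⟩ k
  rw [mul_copyIncl_apply, copyIncl_mul_apply]
  simp [Matrix.one_apply]

open scoped Kronecker in
theorem eq_one_kronecker {α ι : Type} [Fintype α] [Fintype ι] [DecidableEq α] [DecidableEq ι]
    {G : Matrix (α × ι) (α × ι) ℂ} {H : Matrix ι ι ℂ}
    (h : ∀ a : α, G * copyIncl ι a = copyIncl ι a * H) : G = (1 : Matrix α α ℂ) ⊗ₖ H := by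
  ext c ⟨a, k⟩
  rw [← mul_copyIncl_apply G, h, ← one_kronecker_mul_copyIncl, mul_copyIncl_apply]

open scoped Kronecker in
theorem polyEval_one_kronecker {α ι : Type} [Fintype α] [Fintype ι] [DecidableEq α]
    [DecidableEq ι] (A : Fin d → Matrix ι ι ℂ) (p : FreeAlgebra ℂ (Fin d)) :
    polyEval (fun j => (1 : Matrix α α ℂ) ⊗ₖ A j) p = (1 : Matrix α α ℂ) ⊗ₖ polyEval A p :=
  eq_one_kronecker fun a => polyEval_intertwine (fun j => one_kronecker_mul_copyIncl (A j) a) p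

open scoped Kronecker in
theorem IsNC.apply_one_kronecker {Ω : GradedSet d} (hΩ : DsumClosed Ω) {F : GradedFun Ω}
    (hF : IsNC F) {α : Type} [Fintype α] [DecidableEq α] {m n : ℕ+} (e : α × Idx m ≃ Idx n)
    (A : Ω m) (hA : relabel e (fun j => (1 : Matrix α α ℂ) ⊗ₖ A.1 j) ∈ Ω n) :
    (F n ⟨_, hA⟩).submatrix e e = (1 : Matrix α α ℂ) ⊗ₖ F m A :=
  eq_one_kronecker fun a => hF.intertwine_relabel hΩ e (Equiv.refl (Idx m)) _ A.1 hA A.2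
    (copyIncl _ a) fun j => one_kronecker_mul_copyIncl (A.1 j) a

theorem isHereditary_zeroSet (T : Set (HInf (opBall Q))) : IsHereditary Q (zeroSet Q T) where
  subset := zeroSet_subset Q T
  dsum m n X Y := fun ⟨hX, hX0⟩ ⟨hY, hY0⟩ => ⟨opBall_dsumClosed hX hY, fun F hF => by
    have h := F.2.1.map_dsum m n ⟨X, hX⟩ ⟨Y, hY⟩ (opBall_dsumClosed hX hY)
    rw [h, hX0 F hF, hY0 F hF]
    simpa using dsum_smul_one (m := m) (n := n) 0⟩
  amplify e A := fun ⟨hA, hA0⟩ => by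
    have hmem := isHereditary_opBall.amplify e A hA
    refine ⟨hmem, fun F hF => ?_⟩
    have h := F.2.1.apply_one_kronecker opBall_dsumClosed e ⟨A, hA⟩ hmem
    rw [hA0 F hF, Matrix.kronecker_zero] at h
    ext i k
    have h1 := congrFun (congrFun h (e.symm i)) (e.symm k)
    simpa using h1
  restrict := by
    rintro m n A B ⟨hA, hA0⟩ hB L L' hL h
    refine ⟨hB, fun F hF => ?_⟩
    have h1 := F.2.1.intertwine opBall_dsumClosed ⟨A, hA⟩ ⟨B, hB⟩ L h
    rw [hA0 F hF, Matrix.zero_mul] at h1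
    rw [← Matrix.one_mul (F.1 n _), ← hL, Matrix.mul_assoc, ← h1, Matrix.mul_zero]

open scoped Kronecker in
open Matrix in
/-- The value of an nc function at a point `A` of a hereditary set is a polynomial in `A`: the
amplification of `A` leaves invariant the cyclic subspace generated by the vector `1 ∈ M_m`, and so
does the amplification of the value. -/
theorem IsHereditary.exists_polyEval_eq {Ω : GradedSet d} (hΩ : IsHereditary Q Ω)
    {F : GradedFun Ω} (hF : IsNC F) {m : ℕ+} (A : Ω m) :
    ∃ p : FreeAlgebra ℂ (Fin d), F m A = polyEval A.1 p := by
  obtain ⟨n, ⟨e⟩⟩ := exists_equiv_Idx (Idx m × Idx m)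
  let A' : Fin d → Matrix (Idx m × Idx m) (Idx m × Idx m) ℂ :=
    fun j => (1 : Matrix (Idx m) (Idx m) ℂ) ⊗ₖ A.1 j
  have hA' : relabel e A' ∈ Ω n := hΩ.amplify e A.1 A.2
  -- the vector `1 ∈ M_m`; applying `1 ⊗ G` to it recovers the matrix `G`
  let ξ : Idx m × Idx m → ℂ := fun c => if c.1 = c.2 then 1 else 0
  have hξ : ∀ (G : Mat m) (a i : Idx m), (((1 : Mat m) ⊗ₖ G) *ᵥ ξ) (a, i) = G i a :=
    fun G a i => by
    rw [Matrix.mulVec, dotProduct, Fintype.sum_prod_type, Finset.sum_eq_single a]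
    · simp [ξ]
    · intro b _ hb
      simp [Matrix.one_apply_ne hb.symm]
    · simp
  let M : Submodule ℂ (Idx m × Idx m → ℂ) := LinearMap.range
    ((Matrix.mulVecBilin ℂ ℂ).flip ξ ∘ₗ (polyEval A').toLinearMap)
  have hM : ∀ p, polyEval A' p *ᵥ ξ ∈ M := fun p => ⟨p, rfl⟩
  have hMinv : ∀ j, ∀ x ∈ M, A' j *ᵥ x ∈ M := by
    rintro j _ ⟨p, rfl⟩
    have h := hM (FreeAlgebra.ι ℂ j * p)
    rw [map_mul, polyEval_ι, ← mulVec_mulVec] at h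
    exact h
  have hξM : ξ ∈ M := by
    have h := hM 1
    rwa [map_one, one_mulVec] at h
  obtain ⟨k, V, hV, hVM, hV'⟩ := exists_isometry_onto M
  have hk : 0 < k := by
    rcases Nat.eq_zero_or_pos k with rfl | hk
    · exfalso
      have h := hVM ξ hξM
      have h1 := congrFun h (Classical.arbitrary _, Classical.arbitrary _)
      have i : Idx m := Classical.arbitrary _
      have h1 := congrFun h (i, i)
      simp [Matrix.mulVec, dotProduct, ξ] at h1
    · exact hk
  let k' : ℕ+ := ⟨k, hk⟩
  let e' : Fin k ≃ Idx k' := Equiv.refl _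
  let B : Fin d → Matrix (Fin k) (Fin k) ℂ := fun j => Vᴴ * A' j * V
  have hAV : ∀ j, A' j * V = V * B j := fun j => by
    refine Matrix.mulVec_injective (funext fun c => ?_)
    simp only [B, ← mulVec_mulVec]
    exact (hVM _ (hMinv j _ (hV' c))).symm
  have hBball : relabel e' B ∈ opBall Q k' := relabel_mem_opBall e'
    ((norm_evalQ_compress_le Q hV A').trans_lt
      ((norm_evalQ_one_kronecker_le Q A.1).trans_lt (hΩ.subset m A.2)))
  have hB : relabel e' B ∈ Ω k' := by
    refine hΩ.restrict hA' hBball (V.submatrix e.symm e'.symm) (Vᴴ.submatrix e'.symm e.symm) ?_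
      fun j => ?_
    · rw [Matrix.submatrix_mul_equiv, hV, Matrix.submatrix_one_equiv]
    · simp only [relabel, Matrix.reindex_apply, Matrix.submatrix_mul_equiv, hAV]
  have h1 := hF.intertwine_relabel hΩ.dsum e e' A' B hA' hB V hAV
  rw [hF.apply_one_kronecker hΩ.dsum e A hA'] at h1
  have h2 : ((1 : Mat m) ⊗ₖ F m A) *ᵥ ξ ∈ M := by
    rw [← hVM ξ hξM, mulVec_mulVec, h1, ← mulVec_mulVec]
    exact hV' _
  obtain ⟨p, hp⟩ := h2
  refine ⟨p, ?_⟩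
  have hp' : polyEval A' p *ᵥ ξ = ((1 : Mat m) ⊗ₖ F m A) *ᵥ ξ := hp
  rw [polyEval_one_kronecker] at hp'
  ext i a
  rw [← hξ (F m A), ← hp', hξ]

/-- Simultaneous polynomial values at two points. -/
theorem IsHereditary.exists_polyEval_eq_pair {Ω : GradedSet d} (hΩ : IsHereditary Q Ω)
    {F : GradedFun Ω} (hF : IsNC F) {m n : ℕ+} (A : Ω m) (B : Ω n) :
    ∃ p : FreeAlgebra ℂ (Fin d), F m A = polyEval A.1 p ∧ F n B = polyEval B.1 p := by
  obtain ⟨p, hp⟩ := hΩ.exists_polyEval_eq hF ⟨_, hΩ.dsum A.2 B.2⟩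
  rw [hF.map_dsum m n A B, polyEval_dsumTup] at hp
  exact ⟨p, dsum_inj hp⟩

/-- A point of the ball belongs to a variety as soon as it satisfies all polynomial relations of
a point of the variety. -/
theorem mem_zeroSet_of_ker_le {T : Set (HInf (opBall Q))} {m n : ℕ+} (Y : zeroSet Q T m)
    (W : opBall Q n) (h : ∀ p, polyEval Y.1 p = 0 → polyEval W.1 p = 0) :
    W.1 ∈ zeroSet Q T n := by
  refine ⟨W.2, fun F hF => ?_⟩
  obtain ⟨hY, hY0⟩ := Y.2
  obtain ⟨p, hp1, hp2⟩ := isHereditary_opBall.exists_polyEval_eq_pair F.2.1 ⟨Y.1, hY⟩ W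
  rw [hY0 F hF] at hp1
  exact hp2.trans (h p hp1.symm)

/-- If `W` satisfies all polynomial relations of `Y`, a polynomial that represents `F` at `Y` also
represents it at `W`. -/
theorem IsHereditary.eq_polyEval_of_ker_le {Ω : GradedSet d} (hΩ : IsHereditary Q Ω)
    {F : GradedFun Ω} (hF : IsNC F) {m n : ℕ+} (Y : Ω m) (W : Ω n)
    (h : ∀ p, polyEval Y.1 p = 0 → polyEval W.1 p = 0) {p : FreeAlgebra ℂ (Fin d)}
    (hp : F m Y = polyEval Y.1 p) : F n W = polyEval W.1 p := by
  obtain ⟨q, hq1, hq2⟩ := hΩ.exists_polyEval_eq_pair hF Y W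
  have h1 := h (q - p) (by rw [map_sub, ← hq1, ← hp, sub_self])
  rw [map_sub, sub_eq_zero] at h1
  exact hq2.trans h1

end Ball

/-! ### Interpolation on nc subvarieties -/

open Matrix in
theorem norm_star_dotProduct_mulVec_le {ι : Type} [Fintype ι] [DecidableEq ι]
    (x : Matrix ι ι ℂ) (u v : ι → ℂ) :
    ‖star u ⬝ᵥ (x *ᵥ v)‖ ≤ ‖x‖ * (‖WithLp.toLp 2 u‖ * ‖WithLp.toLp 2 v‖) := by
  have h : star u ⬝ᵥ (x *ᵥ v) = inner ℂ (WithLp.toLp 2 u : EuclideanSpace ℂ ι)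
      (WithLp.toLp 2 (x *ᵥ v)) := by
    rw [EuclideanSpace.inner_eq_star_dotProduct, dotProduct_comm]
  rw [h]
  calc _ ≤ ‖(WithLp.toLp 2 u : EuclideanSpace ℂ ι)‖ *
          ‖(WithLp.toLp 2 (x *ᵥ v) : EuclideanSpace ℂ ι)‖ := norm_inner_le_norm _ _
    _ ≤ ‖WithLp.toLp 2 u‖ * (‖x‖ * ‖WithLp.toLp 2 v‖) := by
        gcongr
        exact Matrix.l2_opNorm_mulVec x (WithLp.toLp 2 v)
    _ = _ := by ring

open Matrix in
theorem norm_conjTranspose_mulVec_le_one {κ : Type} [Fintype κ] [DecidableEq κ] {k : ℕ}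
    {V : Matrix κ (Fin k) ℂ} (hV : Vᴴ * V = 1) {ξ : κ → ℂ} (hξ : ∑ c, ‖ξ c‖ ^ 2 ≤ 1) :
    ‖(WithLp.toLp 2 (Vᴴ *ᵥ ξ) : EuclideanSpace ℂ (Fin k))‖ ≤ 1 := by
  have h1 : ‖(WithLp.toLp 2 ξ : EuclideanSpace ℂ κ)‖ ≤ 1 := by
    rw [EuclideanSpace.norm_eq]
    exact Real.sqrt_le_iff.2 ⟨zero_le_one, by simpa using hξ⟩
  exact (Matrix.l2_opNorm_mulVec Vᴴ (WithLp.toLp 2 ξ)).trans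
    (mul_le_one₀ (norm_conjTranspose_le_one hV) (norm_nonneg _) h1)

section Ball

variable {d : ℕ} {R : Type u} {S : Type v}
  [NormedAddCommGroup R] [InnerProductSpace ℂ R]
  [NormedAddCommGroup S] [InnerProductSpace ℂ S] {Q : Fin d → R →L[ℂ] S}

open scoped Kronecker in
open Matrix in
/-- The duality estimate behind the interpolation theorem. A contractive functional on `M_n`
annihilating `{q(X) : q(Y) = 0}` is a vector functional of an amplification of `X`; it only sees the
compression `W` of the amplification to `M ⊖ N`, where `M` is the cyclic subspace and `N` the part
of it coming from the polynomials vanishing at `Y`. The tuple `W` satisfies all polynomial relations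
of `Y`, so it lies in the variety and `p(W) = F(W)`. -/
theorem norm_functional_le {T : Set (HInf (opBall Q))} {F : GradedFun (zeroSet Q T)} (hF : IsNC F)
    {C : ℝ} (hC : ∀ (n : ℕ+) (Z : zeroSet Q T n), ‖F n Z‖ ≤ C) {m n : ℕ+} (Y : zeroSet Q T m)
    (X : opBall Q n) {p : FreeAlgebra ℂ (Fin d)} (hp : F m Y = polyEval Y.1 p)
    (φ : Mat n →ₗ[ℂ] ℂ) (hφ : ∀ x, ‖φ x‖ ≤ ‖x‖)
    (hφ0 : ∀ q, polyEval Y.1 q = 0 → φ (polyEval X.1 q) = 0) : ‖φ (polyEval X.1 p)‖ ≤ C := by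
  have hC0 : 0 ≤ C := (norm_nonneg _).trans (hC m Y)
  obtain ⟨ξ, η, hξ1, hη1, hval⟩ := exists_vectors_of_norm_le φ hφ
  let X' : Fin d → Matrix (Idx n × Idx n) (Idx n × Idx n) ℂ := fun j => (1 : Mat n) ⊗ₖ X.1 j
  have hval' : ∀ q, φ (polyEval X.1 q) = star η ⬝ᵥ (polyEval X' q *ᵥ ξ) := fun q => by
    rw [hval, polyEval_one_kronecker]
  let ψ : FreeAlgebra ℂ (Fin d) →ₗ[ℂ] (Idx n × Idx n → ℂ) :=
    (Matrix.mulVecBilin ℂ ℂ).flip ξ ∘ₗ (polyEval X').toLinearMap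
  have hψ : ∀ q, ψ q = polyEval X' q *ᵥ ξ := fun _ => rfl
  let M := LinearMap.range ψ
  let N := (LinearMap.ker (polyEval Y.1).toLinearMap).map ψ
  have hNmem : ∀ q, polyEval Y.1 q = 0 → polyEval X' q *ᵥ ξ ∈ N := fun q hq => ⟨q, hq, rfl⟩
  have hM : ∀ q, ∀ x ∈ M, polyEval X' q *ᵥ x ∈ M := by
    rintro q _ ⟨r, rfl⟩
    exact ⟨q * r, by rw [hψ, hψ, map_mul, mulVec_mulVec]⟩
  have hN : ∀ q, ∀ x ∈ N, polyEval X' q *ᵥ x ∈ N := by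
    rintro q _ ⟨r, hr, rfl⟩
    have hr' : polyEval Y.1 r = 0 := hr
    rw [hψ, mulVec_mulVec, ← map_mul]
    exact hNmem _ (by rw [map_mul, hr', mul_zero])
  have hMN : ∀ q, polyEval Y.1 q = 0 → ∀ x ∈ M, polyEval X' q *ᵥ x ∈ N := by
    rintro q hq _ ⟨r, rfl⟩
    rw [hψ, mulVec_mulVec, ← map_mul]
    exact hNmem _ (by rw [map_mul, hq, zero_mul])
  have hηN : ∀ x ∈ N, star η ⬝ᵥ x = 0 := by
    rintro _ ⟨q, hq, rfl⟩
    rw [hψ, ← hval', hφ0 q hq]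
  have hξM : ξ ∈ M := ⟨1, by rw [hψ, map_one, one_mulVec]⟩
  obtain ⟨k, V, P, hV, hP, hVN, hdec, hVM⟩ :=
    exists_isometry_onto_complement (M := M) (N := N) LinearMap.map_le_range
  let W : Fin d → Matrix (Fin k) (Fin k) ℂ := fun j => Vᴴ * X' j * V
  have hW : ∀ q, polyEval W q = Vᴴ * polyEval X' q * V :=
    polyEval_compression hM hN hV hP hVN hdec hVM
  have hφW : φ (polyEval X.1 p) = star (Vᴴ *ᵥ η) ⬝ᵥ (polyEval W p *ᵥ (Vᴴ *ᵥ ξ)) := by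
    have h1 : polyEval X' p *ᵥ ξ =
        polyEval X' p *ᵥ (P *ᵥ ξ) + polyEval X' p *ᵥ (V *ᵥ (Vᴴ *ᵥ ξ)) := by
      rw [← mulVec_add, ← hdec ξ hξM]
    have h2 := hdec _ (hM p _ (hVM (Vᴴ *ᵥ ξ)))
    rw [hval', h1, dotProduct_add, hηN _ (hN p _ (hP ξ)), zero_add, h2, dotProduct_add,
      hηN _ (hP _), zero_add, hW, dotProduct_mulVec, star_mulVec, conjTranspose_conjTranspose]
    simp only [← mulVec_mulVec]
  have hWC : ‖polyEval W p‖ ≤ C := by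
    rcases Nat.eq_zero_or_pos k with rfl | hk
    · rw [Subsingleton.elim (polyEval W p) 0, norm_zero]
      exact hC0
    let k' : ℕ+ := ⟨k, hk⟩
    let W' : Tup d k' := W
    have hWball : W' ∈ opBall Q k' := (norm_evalQ_compress_le Q hV X').trans_lt
      ((norm_evalQ_one_kronecker_le Q X.1).trans_lt X.2)
    have hker : ∀ q, polyEval Y.1 q = 0 → polyEval W q = 0 := fun q hq => by
      refine (hW q).trans (Matrix.mulVec_injective (funext fun c => ?_))
      rw [← mulVec_mulVec, ← mulVec_mulVec, hVN _ (hMN q hq _ (hVM c)), zero_mulVec]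
    have hWV := mem_zeroSet_of_ker_le Y ⟨W', hWball⟩ hker
    have h := (isHereditary_zeroSet T).eq_polyEval_of_ker_le hF Y ⟨W', hWV⟩ hker hp
    have h' := hC k' ⟨W', hWV⟩
    rw [h] at h'
    exact h'
  rw [hφW]
  calc _ ≤ _ := norm_star_dotProduct_mulVec_le _ _ _
    _ ≤ C * (1 * 1) := by
        gcongr
        · exact norm_conjTranspose_mulVec_le_one hV hη1
        · exact norm_conjTranspose_mulVec_le_one hV hξ1
    _ = C := by ring

/-- Interpolation of a bounded nc function on a variety by a polynomial at one point, with control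
of the polynomial at another point of the ball. -/
theorem exists_interpolating_poly {T : Set (HInf (opBall Q))} {F : GradedFun (zeroSet Q T)}
    (hF : IsNC F) {C : ℝ} (hC : ∀ (n : ℕ+) (Z : zeroSet Q T n), ‖F n Z‖ ≤ C) {m n : ℕ+}
    (Y : zeroSet Q T m) (X : opBall Q n) :
    ∃ p : FreeAlgebra ℂ (Fin d), F m Y = polyEval Y.1 p ∧ ‖polyEval X.1 p‖ ≤ C + 1 := by
  obtain ⟨p, hp⟩ := (isHereditary_zeroSet T).exists_polyEval_eq hF Y
  let N : Submodule ℂ (Mat n) :=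
    (LinearMap.ker (polyEval Y.1).toLinearMap).map (polyEval X.1).toLinearMap
  obtain ⟨g, hg1, hg⟩ := exists_dual_vector'' ℂ (Submodule.Quotient.mk (p := N) (polyEval X.1 p))
  have hle : ‖(Submodule.Quotient.mk (polyEval X.1 p) : Mat n ⧸ N)‖ ≤ C := by
    have h := norm_functional_le hF hC Y X hp (g.toLinearMap ∘ₗ N.mkQ)
      (fun x => by
        refine (g.le_opNorm _).trans ?_
        calc _ ≤ 1 * ‖x‖ := by
              gcongr
              exact Submodule.Quotient.norm_mk_le N x
          _ = _ := one_mul _)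
      (fun q hq => by
        have hmem : polyEval X.1 q ∈ N := ⟨q, hq, rfl⟩
        have h0 : N.mkQ (polyEval X.1 q) = 0 := (Submodule.Quotient.mk_eq_zero N).2 hmem
        rw [LinearMap.comp_apply, h0, map_zero])
    have h2 : (g.toLinearMap ∘ₗ N.mkQ) (polyEval X.1 p) =
      (‖(Submodule.Quotient.mk (polyEval X.1 p) : Mat n ⧸ N)‖ : ℂ) := hg
    rw [h2, Complex.norm_real, norm_norm] at h
    exact h
  obtain ⟨x, hx, hxn⟩ := Submodule.Quotient.norm_mk_lt (S := N)
    (Submodule.Quotient.mk (polyEval X.1 p)) zero_lt_one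
  rw [Submodule.Quotient.eq] at hx
  obtain ⟨q, hq, hqx⟩ := hx
  have hq' : polyEval Y.1 q = 0 := hq
  have hqx' : polyEval X.1 q = x - polyEval X.1 p := hqx
  refine ⟨p + q, by rw [map_add, hq', add_zero, hp], ?_⟩
  rw [map_add, hqx', add_sub_cancel]
  linarith

end Ball

/-! ### Extension from nc subvarieties to the ball -/

section Ball

variable {d : ℕ} {R : Type u} {S : Type v}
  [NormedAddCommGroup R] [InnerProductSpace ℂ R]
  [NormedAddCommGroup S] [InnerProductSpace ℂ S] {Q : Fin d → R →L[ℂ] S}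

theorem norm_le_norm_dsum_left {m n : ℕ+} (A : Mat m) (B : Mat n) : ‖A‖ ≤ ‖dsum A B‖ := by
  have h : A = (dsum A B).submatrix (fun i => sumEquiv m n (Sum.inl i))
      fun i => sumEquiv m n (Sum.inl i) := by
    ext i k
    simp [dsum]
  conv_lhs => rw [h]
  refine norm_submatrix_le _ ?_ ?_ <;> exact (sumEquiv m n).injective.comp Sum.inl_injective

theorem norm_le_norm_dsum_right {m n : ℕ+} (A : Mat m) (B : Mat n) : ‖B‖ ≤ ‖dsum A B‖ := by
  have h : B = (dsum A B).submatrix (fun i => sumEquiv m n (Sum.inr i))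
      fun i => sumEquiv m n (Sum.inr i) := by
    ext i k
    simp [dsum]
  conv_lhs => rw [h]
  refine norm_submatrix_le _ ?_ ?_ <;> exact (sumEquiv m n).injective.comp Sum.inr_injective

/-- The direct sum of finitely many points dominates each of them. -/
theorem exists_dominating_point (E : Finset (Σ n, opBall Q n)) :
    ∃ (n : ℕ+) (X : opBall Q n), ∀ Z ∈ E, ∀ p, ‖polyEval Z.2.1 p‖ ≤ ‖polyEval X.1 p‖ := by
  classical
  induction E using Finset.induction_on with
  | empty => exact ⟨1, ⟨0, zero_mem_opBall 1⟩, by simp⟩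
  | insert Z E _ ih =>
    obtain ⟨n, X, hX⟩ := ih
    refine ⟨_, ⟨_, opBall_dsumClosed Z.2.2 X.2⟩, fun W hW p => ?_⟩
    simp only [polyEval_dsumTup]
    rcases Finset.mem_insert.1 hW with rfl | hW
    · exact norm_le_norm_dsum_left _ _
    · exact (hX W hW p).trans (norm_le_norm_dsum_right _ _)

/-- A polynomial that represents `F` at the direct sum of finitely many points does so at each of
them. The point `Y₀` serves when there are none. -/
theorem IsHereditary.exists_determining_point {Ω : GradedSet d} (hΩ : IsHereditary Q Ω)
    {F : GradedFun Ω} (hF : IsNC F) {m₀ : ℕ+} (Y₀ : Ω m₀) (E : Finset (Σ n, Ω n)) :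
    ∃ (m : ℕ+) (Y : Ω m), ∀ p, F m Y = polyEval Y.1 p →
      ∀ Z ∈ E, F Z.1 Z.2 = polyEval Z.2.1 p := by
  classical
  induction E using Finset.induction_on with
  | empty => exact ⟨m₀, Y₀, by simp⟩
  | insert Z E _ ih =>
    obtain ⟨m, Y, hY⟩ := ih
    refine ⟨_, ⟨_, hΩ.dsum Z.2.2 Y.2⟩, fun p hp W hW => ?_⟩
    rw [hF.map_dsum _ _ Z.2 Y, polyEval_dsumTup] at hp
    obtain ⟨h1, h2⟩ := dsum_inj hp
    rcases Finset.mem_insert.1 hW with rfl | hW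
    · exact h1
    · exact hY p h2 W hW

/-- A bounded nc function on a nonempty nc subvariety extends to a bounded nc function on the ball:
a pointwise limit, along an ultrafilter on the finite sets of points, of interpolating
polynomials. -/
theorem exists_extension {T : Set (HInf (opBall Q))} (F : HInf (zeroSet Q T)) {m₀ : ℕ+}
    (Y₀ : zeroSet Q T m₀) :
    ∃ G : HInf (opBall Q), ∀ (n : ℕ+) (Z : zeroSet Q T n),
      G.1 n ⟨Z.1, zeroSet_subset Q T n Z.2⟩ = F.1 n Z := by
  classical
  obtain ⟨hF, C, hC⟩ := F.2
  let I := Finset (Σ n, opBall Q n) × Finset (Σ n, zeroSet Q T n)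
  have hI : ∀ E : I, ∃ p : FreeAlgebra ℂ (Fin d),
      (∀ Z ∈ E.1, ‖polyEval Z.2.1 p‖ ≤ C + 1) ∧ ∀ Z ∈ E.2, F.1 Z.1 Z.2 = polyEval Z.2.1 p := by
    intro E
    obtain ⟨n, X, hX⟩ := exists_dominating_point E.1
    obtain ⟨m, Y, hY⟩ := (isHereditary_zeroSet T).exists_determining_point hF Y₀ E.2
    obtain ⟨p, hp1, hp2⟩ := exists_interpolating_poly hF hC Y X
    exact ⟨p, fun Z hZ => (hX Z hZ p).trans hp2, hY p hp1⟩
  choose p hp1 hp2 using hI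
  let 𝒰 : Ultrafilter I := Ultrafilter.of Filter.atTop
  have h𝒰 : (𝒰 : Filter I) ≤ Filter.atTop := Ultrafilter.of_le _
  have hlim : ∀ (n : ℕ+) (X : opBall Q n), ∃ G ∈ Metric.closedBall (0 : Mat n) (C + 1),
      Filter.Tendsto (fun E => polyEval X.1 (p E)) 𝒰 (nhds G) := by
    intro n X
    have : ProperSpace (Mat n) := FiniteDimensional.proper ℂ (Mat n)
    have hev : ∀ᶠ E in (𝒰 : Filter I),
        polyEval X.1 (p E) ∈ Metric.closedBall (0 : Mat n) (C + 1) := by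
      refine h𝒰 ((Filter.eventually_ge_atTop (({⟨n, X⟩}, ∅) : I)).mono fun E hE => ?_)
      rw [mem_closedBall_zero_iff]
      exact hp1 E ⟨n, X⟩ (hE.1 (Finset.mem_singleton_self _))
    exact (isCompact_closedBall (0 : Mat n) (C + 1)).ultrafilter_le_nhds
      (𝒰.map fun E => polyEval X.1 (p E)) (Filter.le_principal_iff.2 hev)
  choose G hGC hG using hlim
  have hGnc : IsNC (Ω := opBall Q) G := IsNC.of_intertwine fun m n A B L h => by
    have h1 : Filter.Tendsto (fun E => polyEval A.1 (p E) * L) 𝒰 (nhds (G m A * L)) :=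
      ((continuous_id.matrix_mul continuous_const).tendsto (G m A)).comp (hG m A)
    have h2 : Filter.Tendsto (fun E => L * polyEval B.1 (p E)) 𝒰 (nhds (L * G n B)) :=
      ((continuous_const.matrix_mul continuous_id).tendsto (G n B)).comp (hG n B)
    refine tendsto_nhds_unique h1 (h2.congr fun E => ?_)
    exact (polyEval_intertwine h (p E)).symm
  refine ⟨⟨G, hGnc, C + 1, fun n X => mem_closedBall_zero_iff.1 (hGC n X)⟩, fun n Z => ?_⟩
  refine tendsto_nhds_unique (hG n ⟨Z.1, zeroSet_subset Q T n Z.2⟩) (tendsto_const_nhds.congr' ?_)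
  refine h𝒰 ((Filter.eventually_ge_atTop ((∅, {⟨n, Z⟩}) : I)).mono fun E hE => ?_)
  exact hp2 E ⟨n, Z⟩ (hE.2 (Finset.mem_singleton_self _))

/-- Restriction of bounded nc functions to a smaller set. -/
def restrictHom {Ω Ω' : GradedSet d} (h : ∀ n, Ω' n ⊆ Ω n) : HInf Ω →ₐ[ℂ] HInf Ω' where
  toFun F := ⟨fun n X => F.1 n ⟨X.1, h n X.2⟩,
    ⟨fun m n X Y hXY => F.2.1.map_dsum m n ⟨X.1, h m X.2⟩ ⟨Y.1, h n Y.2⟩ (h _ hXY),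
      fun n S X hX => F.2.1.map_conj n S ⟨X.1, h n X.2⟩ (h n hX)⟩,
    F.2.2.imp fun _ hC n X => hC n ⟨X.1, h n X.2⟩⟩
  map_one' := rfl
  map_mul' _ _ := rfl
  map_zero' := rfl
  map_add' _ _ := rfl
  commutes' _ := rfl

theorem IsCC.comp_restrictHom {Ω Ω' : GradedSet d} (h : ∀ n, Ω' n ⊆ Ω n) {n : ℕ+}
    {Φ : HInf Ω' →ₐ[ℂ] Mat n} (hΦ : IsCC Φ) : IsCC (Φ.comp (restrictHom h)) := fun k A =>
  (hΦ k (A.map (restrictHom h))).trans <| iSup₂_le fun m X =>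
    le_iSup₂ (f := fun m X => ‖Matrix.comp _ _ _ _ _ (A.map fun F : HInf Ω => F.1 m X)‖ₑ) m
      ⟨X.1, h m X.2⟩

end Ball

end NCBall

end

theorem mainTheorem7 {d : ℕ} {R : Type*} {S : Type*}
    [NormedAddCommGroup R] [InnerProductSpace ℂ R] [CompleteSpace R]
    [NormedAddCommGroup S] [InnerProductSpace ℂ S] [CompleteSpace S]
    (Q : Fin d → R →L[ℂ] S) (hQ : LinearIndependent ℂ Q) (hreg : NCBall.IsRightRegular Q) :
    (∀ (n : ℕ+) (X : NCBall.opBall Q n) (Φ : NCBall.HInf (NCBall.opBall Q) →ₐ[ℂ] NCBall.Mat n),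
      (NCBall.IsCC Φ ∧ NCBall.proj Q hQ (fun _ => subset_rfl) Φ = X.1) ↔
        Φ = NCBall.pointEval X) ∧
    (∀ (T : Set (NCBall.HInf (NCBall.opBall Q))) (n : ℕ+) (X : NCBall.zeroSet Q T n)
      (Φ : NCBall.HInf (NCBall.zeroSet Q T) →ₐ[ℂ] NCBall.Mat n),
      (NCBall.IsCC Φ ∧ NCBall.proj Q hQ (NCBall.zeroSet_subset Q T) Φ = X.1) ↔
        Φ = NCBall.pointEval X) := by
  refine ⟨fun n X Φ => ⟨fun h => ?_, ?_⟩, fun T n X Φ => ⟨fun h => ?_, ?_⟩⟩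
  · exact hreg.eq_of_proj_eq hQ X h.1 (NCBall.pointEval_isCC X) h.2 rfl
  · rintro rfl
    exact ⟨NCBall.pointEval_isCC X, rfl⟩
  · refine AlgHom.ext fun F => ?_
    obtain ⟨G, hG⟩ := NCBall.exists_extension F X
    let X' : NCBall.opBall Q n := ⟨X.1, NCBall.zeroSet_subset Q T n X.2⟩
    have hΦ := hreg.eq_of_proj_eq hQ X' (h.1.comp_restrictHom (NCBall.zeroSet_subset Q T))
      (NCBall.pointEval_isCC X') h.2 rfl
    have hF : NCBall.restrictHom (NCBall.zeroSet_subset Q T) G = F :=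
      Subtype.ext (funext fun n => funext fun Z => hG n Z)
    rw [← hF]
    exact DFunLike.congr_fun hΦ G
  · rintro rfl
    exact ⟨NCBall.pointEval_isCC X, rfl⟩
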